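/- **Setting.** Consider a step-stress experiment with stress levels $x_1<\dots<x_k$, times of stress change $\tau_1<\dots<\tau_{k-1}$, termination time $\tau_k>\tau_{k-1}$, and inspection times $0=t_0<t_1<\dots<t_L=\tau_k$ that include $\tau_1,\dots,\tau_k$. The parameter is $\theta=(a_0,a_1,\eta)^T\in\Theta=\mathbb R\times(-\infty,0)\times(0,\infty)$, and $\lambda_i=\exp(a_0+a_1x_i)$. Let $h_0=0$ and let $h_i$ ($1\le i\le k-1$) be determined by $(\tau_i+h_i)/\lambda_{i+1}=(\tau_i+h_{i-1})/\lambda_i$. The lifetime has distribution function $F_T(t)=1-\exp\big(-((t+h_{i-1})/\lambda_i)^{\eta}\big)$ for $\tau_{i-1}<t\le\tau_i$ (with $\tau_0=0$, $F_T(0)=0$) and density $g_T$. The cell probabilities are $\pi_j(\theta)=F_T(t_j)-F_T(t_{j-1})$ for $1\le j\le L$ and $\pi_{L+1}(\theta)=1-F_T(t_L)$. Let $D_\pi=\operatorname{diag}(\pi_1,\dots,\pi_{L+1})$, and let $W=W(\theta)$ be the $(L+1)\times3$ matrix with rows $w_j=z_j-z_{j-1}$, where $z_0=z_{L+1}=0$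 and, for $1\le j\le L$ and $\tau_{i-1}<t_j\le\tau_i$, $$z_j=g_T(t_j)\Big(-(t_j+h_{i-1}),\ -(t_j+h_{i-1})x_i+h^*_{i-1},\ \log\!\Big(\frac{t_j+h_{i-1}}{\lambda_i}\Big)\frac{t_j+h_{i-1}}{\eta}\Big),$$ $$h_i^*=h_ix_{i+1}+\lambda_{i+1}\sum_{l=1}^{i}\Big(\frac{x_{l+1}}{\lambda_{l+1}}-\frac{x_l}{\lambda_l}\Big)\tau_l .$$ Let $m:\Theta\to\mathbb R^r$ be continuously differentiable, with $3\times r$ derivative matrix $M(\theta)=\partial m^T(\theta)/\partial\theta$ of rank $r$ at every $\theta\in\Theta$ (so $r\le 3$). Let $\beta\ge0$. For a vector $\hat p$ of relative frequencies let $d_\beta(\hat p,\pi(\theta))=\sum_{j=1}^{L+1}\big(\pi_j^{1+\beta}-(1+\tfrac1\beta)\hat p_j\pi_j^\beta+\tfrac1\beta\hat p_j^{\beta+1}\big)$ if $\beta>0$, and $d_0(\hat p,\pi(\theta))=\sum_j\hat p_j\log(\hat p_j/\pi_j)$. An RMDPDE is a minimizer of $\theta\mapsto d_\beta(\hat p,\pi(\theta))$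 over $\{\theta\in\Theta: m(\theta)=0\}$. The restricted estimating equations for $\theta\in\Theta$ are $$W^T(\theta)D_{\pi(\theta)}^{\beta-1}(\hat p-\pi(\theta))+M(\theta)\lambda=0\ \text{ for some }\lambda\in\mathbb R^r,\qquad m(\theta)=0 .$$ **Theorem.** Let $\theta_0\in\Theta$ with $m(\theta_0)=0$, and suppose that for every $N$ the counts $(n_1,\dots,n_{L+1})$ are multinomial with $N$ trials and probability vector $\pi(\theta_0)$; let $\hat p=n/N$. Put $J_\beta=W^TD_\pi^{\beta-1}W$, $K_\beta=W^T(D_\pi^{2\beta-1}-\pi^\beta\pi^{\beta T})W$ at $\theta_0$ ($\pi^\beta$ taken componentwise), and assume that $J_\beta(\theta_0)$ is invertible. With $M=M(\theta_0)$ let $$Q_\beta=J_\beta^{-1}M(M^TJ_\beta^{-1}M)^{-1},\qquad P_\beta=J_\beta^{-1}-Q_\beta M^TJ_\beta^{-1},\qquad \Sigma_\beta=P_\beta K_\beta P_\beta^T .$$ Then: 1. The restricted estimating equations have a consistent sequence of roots: there are estimators $\tilde\theta_\beta=\tilde\theta_{\beta,N}$, functions of the counts, that solve the equations with probability tending to $1$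 and satisfy $\tilde\theta_\beta\to\theta_0$ in probability as $N\to\infty$. 2. The matrix $\Sigma_\beta$ is positive semidefinite, and every consistent sequence $\tilde\theta_\beta$ of random vectors that solve the restricted estimating equations with probability tending to $1$ satisfies $\sqrt N(\tilde\theta_\beta-\theta_0)\to\mathcal N(0,\Sigma_\beta)$ in distribution. The same holds for every consistent sequence of random vectors that are RMDPDEs with probability tending to $1$. -/

import Mathlib

open MeasureTheory ProbabilityTheory Filter Topology

noncomputable section

namespace StepStress

/-- A step-stress experiment with interval monitoring. The indices follow the usual numbering:
`x 1 < ⋯ < x k` are the stress levels, `τ 1 < ⋯ < τ (k - 1)` the times at which the stress is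
changed, `τ k` is the termination time, and `0 = t 0 < t 1 < ⋯ < t L` is the grid of inspection
times, which contains `τ 1, …, τ k` and ends at `τ k`. (The values of `x`, `τ` and `t` at other
indices are irrelevant.) -/
structure Design where
  k : ℕ
  L : ℕ
  x : ℕ → ℝ
  τ : ℕ → ℝ
  t : ℕ → ℝ
  one_le_k : 1 ≤ k
  x_strictMonoOn : StrictMonoOn x (Set.Icc 1 k)
  τ_strictMonoOn : StrictMonoOn τ (Set.Icc 1 k)
  t_zero : t 0 = 0
  t_strictMonoOn : StrictMonoOn t (Set.Icc 0 L)
  τ_mem_grid : ∀ i ∈ Set.Icc 1 k, ∃ j ∈ Set.Icc 1 L, t j = τ i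
  t_last : t L = τ k

/-- The space of parameter vectors `θ = (a₀, a₁, η)`, with its Euclidean norm. -/
abbrev Param : Type := EuclideanSpace ℝ (Fin 3)

/-- The parameter space `Θ = ℝ × ℝ⁻ × ℝ⁺`. -/
def paramSpace : Set Param := {θ | θ 1 < 0 ∧ 0 < θ 2}

namespace Design

variable (S : Design)

/-- The Weibull scale parameter `λ_i = exp (a₀ + a₁ x_i)` at the `i`-th stress level. -/
def scale (θ : Param) (i : ℕ) : ℝ := Real.exp (θ 0 + θ 1 * S.x i)

/-- The index of the stress level in force just before time `s`: it is `i` for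
`τ_{i-1} < s ≤ τ_i` (where `τ_0 = 0`). -/
def level (s : ℝ) : ℕ := 1 + ((Finset.Ico 1 S.k).filter (fun i => S.τ i < s)).card

/-- The shifting times `h_0 = 0, h_1, h_2, …` of the cumulative exposure model: `h_i` is the
solution of `F_{i+1} (τ_i + h_i) = F_i (τ_i + h_{i-1})`, that is, of
`(τ_i + h_i) / λ_{i+1} = (τ_i + h_{i-1}) / λ_i`. -/
def shift (θ : Param) : ℕ → ℝ
  | 0 => 0
  | i + 1 =>
    S.scale θ (i + 2) / S.scale θ (i + 1) * (S.τ (i + 1) + shift θ i) - S.τ (i + 1)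

/-- The quantities
`h*_i = h_i x_{i+1} + λ_{i+1} ∑_{l=1}^{i} (x_{l+1} / λ_{l+1} - x_l / λ_l) τ_l`. -/
def shiftStar (θ : Param) (i : ℕ) : ℝ :=
  S.shift θ i * S.x (i + 1) + S.scale θ (i + 1) *
    ∑ l ∈ Finset.Icc 1 i, (S.x (l + 1) / S.scale θ (l + 1) - S.x l / S.scale θ l) * S.τ l

/-- The shifted time `s + h_{i-1}`, where `i` is the stress level in force before `s`. -/
def shiftedTime (θ : Param) (s : ℝ) : ℝ := s + S.shift θ (S.level s - 1)

/-- The lifetime distribution function at time `s ≥ 0`,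
`F_T (s) = 1 - exp (-((s + h_{i-1}) / λ_i) ^ η)`. -/
def lifetimeCDF (θ : Param) (s : ℝ) : ℝ :=
  1 - Real.exp (-(S.shiftedTime θ s / S.scale θ (S.level s)) ^ θ 2)

/-- The lifetime density at time `s > 0`,
`g_T (s) = (η / λ_i) ((s + h_{i-1}) / λ_i) ^ (η - 1) exp (-((s + h_{i-1}) / λ_i) ^ η)`. -/
def lifetimeDensity (θ : Param) (s : ℝ) : ℝ :=
  θ 2 / S.scale θ (S.level s) *
    (S.shiftedTime θ s / S.scale θ (S.level s)) ^ (θ 2 - 1) *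
    Real.exp (-(S.shiftedTime θ s / S.scale θ (S.level s)) ^ θ 2)

/-- The cell probabilities: the entry `j < L` (counted from `0`) is the probability
`F_T (t_{j+1}) - F_T (t_j)` of a failure in `(t_j, t_{j+1}]`, the last entry is the probability
`1 - F_T (t_L)` of surviving the experiment. -/
def cellProb (θ : Param) (j : Fin (S.L + 1)) : ℝ :=
  if (j : ℕ) < S.L then S.lifetimeCDF θ (S.t (j + 1)) - S.lifetimeCDF θ (S.t j)
  else 1 - S.lifetimeCDF θ (S.t S.L)

/-- The vectors `z_j`, for `1 ≤ j ≤ L`, and `z_0 = z_{L+1} = 0`. -/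
def zVec (θ : Param) (j : ℕ) : Fin 3 → ℝ :=
  if 1 ≤ j ∧ j ≤ S.L then
    S.lifetimeDensity θ (S.t j) •
      ![-S.shiftedTime θ (S.t j),
        -S.shiftedTime θ (S.t j) * S.x (S.level (S.t j)) +
          S.shiftStar θ (S.level (S.t j) - 1),
        Real.log (S.shiftedTime θ (S.t j) / S.scale θ (S.level (S.t j))) *
          (S.shiftedTime θ (S.t j) / θ 2)]
  else 0

/-- The `(L + 1) × 3` matrix `W`, whose rows are `w_j = z_j - z_{j-1}`, `1 ≤ j ≤ L + 1` (the row
with index `j` in `Fin (L + 1)` is `w_{j+1}`). -/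
def matW (θ : Param) : Matrix (Fin (S.L + 1)) (Fin 3) ℝ :=
  Matrix.of fun j => S.zVec θ (j + 1) - S.zVec θ j

/-- The power `D_π ^ s` of the diagonal matrix with diagonal entries `π_j(θ)`. -/
def matD (θ : Param) (s : ℝ) : Matrix (Fin (S.L + 1)) (Fin (S.L + 1)) ℝ :=
  Matrix.diagonal fun j => S.cellProb θ j ^ s

/-- `J_β = Wᵀ D_π^{β-1} W`. -/
def matJ (β : ℝ) (θ : Param) : Matrix (Fin 3) (Fin 3) ℝ :=
  (S.matW θ).transpose * S.matD θ (β - 1) * S.matW θ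

/-- `K_β = Wᵀ (D_π^{2β-1} - π^β (π^β)ᵀ) W`. -/
def matK (β : ℝ) (θ : Param) : Matrix (Fin 3) (Fin 3) ℝ :=
  (S.matW θ).transpose *
    (S.matD θ (2 * β - 1) -
      Matrix.vecMulVec (fun j => S.cellProb θ j ^ β) (fun j => S.cellProb θ j ^ β)) *
    S.matW θ

/-- The `β`-score function `U_β(θ) = Wᵀ D_π^{β-1} (p - π(θ))` at the vector `p` of relative
frequencies. -/
def score (β : ℝ) (p : Fin (S.L + 1) → ℝ) (θ : Param) : Fin 3 → ℝ :=
  ((S.matW θ).transpose * S.matD θ (β - 1)).mulVec (p - S.cellProb θ)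

end Design

/-- The `3 × r` matrix `M(θ) = ∂ mᵀ(θ) / ∂ θ` of the constraint function `m`. -/
def matM {r : ℕ} (m : Param → EuclideanSpace ℝ (Fin r)) (θ : Param) :
    Matrix (Fin 3) (Fin r) ℝ :=
  Matrix.of fun a b => fderiv ℝ m θ (EuclideanSpace.single a 1) b

/-- The density power divergence `d_β (p, q)` between probability vectors; for `β = 0` it is the
Kullback-Leibler divergence. -/
def dpd {d : ℕ} (β : ℝ) (p q : Fin d → ℝ) : ℝ :=
  if β = 0 then ∑ j, p j * Real.log (p j / q j)
  else ∑ j, (q j ^ (1 + β) - (1 + 1 / β) * p j * q j ^ β + 1 / β * p j ^ (β + 1))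

namespace Design

variable (S : Design) {r : ℕ}

/-- `θ` is a restricted minimum density power divergence estimate at the relative frequencies `p`:
it minimizes `d_β (p, π(θ))` over the restricted parameter space `{θ ∈ Θ | m θ = 0}`. -/
def IsRMDPDE (β : ℝ) (m : Param → EuclideanSpace ℝ (Fin r)) (p : Fin (S.L + 1) → ℝ)
    (θ : Param) : Prop :=
  (θ ∈ paramSpace ∧ m θ = 0) ∧
    ∀ θ' ∈ paramSpace, m θ' = 0 → dpd β p (S.cellProb θ) ≤ dpd β p (S.cellProb θ')

/-- `θ` is a root of the restricted estimating equations at the relative frequencies `p`: for some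
vector `l` of Lagrange multipliers, `U_β(θ) + M(θ) l = 0` and `m(θ) = 0`. -/
def IsRoot (β : ℝ) (m : Param → EuclideanSpace ℝ (Fin r)) (p : Fin (S.L + 1) → ℝ)
    (θ : Param) : Prop :=
  θ ∈ paramSpace ∧ (∃ l : Fin r → ℝ, S.score β p θ + (matM m θ).mulVec l = 0) ∧ m θ = 0

/-- `Q_β = J_β⁻¹ M (Mᵀ J_β⁻¹ M)⁻¹`. -/
def matQ (β : ℝ) (m : Param → EuclideanSpace ℝ (Fin r)) (θ : Param) :
    Matrix (Fin 3) (Fin r) ℝ :=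
  (S.matJ β θ)⁻¹ * matM m θ * ((matM m θ).transpose * (S.matJ β θ)⁻¹ * matM m θ)⁻¹

/-- `P_β = J_β⁻¹ - Q_β Mᵀ J_β⁻¹`. -/
def matP (β : ℝ) (m : Param → EuclideanSpace ℝ (Fin r)) (θ : Param) :
    Matrix (Fin 3) (Fin 3) ℝ :=
  (S.matJ β θ)⁻¹ - S.matQ β m θ * (matM m θ).transpose * (S.matJ β θ)⁻¹

/-- `Σ_β = P_β K_β P_βᵀ`. -/
def matSigma (β : ℝ) (m : Param → EuclideanSpace ℝ (Fin r)) (θ : Param) :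
    Matrix (Fin 3) (Fin 3) ℝ :=
  S.matP β m θ * S.matK β θ * (S.matP β m θ).transpose

end Design

/-- The random vector of counts `n` has the multinomial distribution with `N` trials and
probability vector `q` under the probability measure `P`. -/
structure HasMultinomialLaw {Ω : Type*} [MeasurableSpace Ω] {d : ℕ} (P : Measure Ω)
    (n : Ω → Fin d → ℕ) (N : ℕ) (q : Fin d → ℝ) : Prop where
  measurable : Measurable n
  prob_eq : ∀ c : Fin d → ℕ, ∑ j, c j = N →
    P {ω | n ω = c} = ENNReal.ofReal (Nat.multinomial Finset.univ c * ∏ j, q j ^ c j)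
  sum_eq : ∀ᵐ ω ∂P, ∑ j, n ω j = N

/-- The vector of relative frequencies `n_j / N`. -/
def relFreq {d : ℕ} (N : ℕ) (c : Fin d → ℕ) : Fin d → ℝ := fun j => (c j : ℝ) / N

section Asymptotics

variable {Ω : ℕ → Type*} [∀ N, MeasurableSpace (Ω N)]

/-- The event `A N` has probability tending to one as `N → ∞` (stated through the outer measure of
its complement). -/
def WithProbTendstoOne (P : ∀ N, Measure (Ω N)) (A : ∀ N, Ω N → Prop) : Prop :=
  Tendsto (fun N => P N {ω | ¬ A N ω}) atTop (𝓝 0)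

/-- Convergence in probability of a sequence of random vectors to the constant `θ₀`. -/
def TendstoInProb (P : ∀ N, Measure (Ω N)) (X : ∀ N, Ω N → Param) (θ₀ : Param) : Prop :=
  ∀ ε > 0, Tendsto (fun N => P N {ω | ε ≤ dist (X N ω) θ₀}) atTop (𝓝 0)

end Asymptotics

end StepStress

end

namespace StepStress

/-! The vectors `z_j` are the gradients of `F_T(t_j)`, so `W` is the Jacobian of the cell
probabilities, and its columns sum to zero. Hence the gradient of `θ ↦ d_β(p, π(θ))` is `-(1 + β)`
times the score. The restricted estimating equations are therefore the Lagrange equations of the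
constrained minimization, and the rank condition on `M` ensures that the objective enters them with
a nonzero multiplier (`isRoot_of_isLocalMinOn`).

Existence. Invertibility of `J_β` makes `W` injective, so `π(θ) ≠ π(θ₀)` for `θ ≠ θ₀` near `θ₀`.
Since the divergence separates probability vectors, compactness shows that, for `p` close to
`π(θ₀)`, it is larger on a small constrained sphere than at `θ₀`. A minimizer over the constrained
ball is then interior, hence a root (`eventually_exists_isRoot`). The law of large numbers places
`p̂` near `π(θ₀)`.

Normality. Multiplying the equations by a matrix that annihilates `M(θ)` removes the multiplier and
leaves `B(θ)(p - π(θ)) = 0` with `B` merely continuous. Together with `m(θ) = 0` this gives `θ - θ₀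
= P_β Wᵀ D_π^{β-1} (p - π(θ₀)) + o(‖p - π(θ₀)‖)` (`eventually_root_expansion`); no second
derivatives occur. The multinomial central limit theorem, proved by characteristic functions, and
Slutsky's lemma give the Gaussian limit. Its covariance is `Σ_β`, because `K_β` is the image of the
one-trial covariance `diag π - π πᵀ` under `Wᵀ D_π^{β-1}`. -/

lemma isOpen_paramSpace : IsOpen paramSpace := by
  have h1 : Continuous fun θ : Param => θ 1 := by fun_prop
  have h2 : Continuous fun θ : Param => θ 2 := by fun_prop
  exact (isOpen_lt h1 continuous_const).inter (isOpen_lt continuous_const h2)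

/-- The linear functional on the parameter space with gradient `z`. -/
noncomputable def gradCLM (z : Fin 3 → ℝ) : Param →L[ℝ] ℝ :=
  ∑ a, z a • EuclideanSpace.proj a

lemma gradCLM_apply (z : Fin 3 → ℝ) (v : Param) : gradCLM z v = ∑ a, z a * v a := by
  simp [gradCLM]

/-! ### The cumulative exposure model and the Jacobian of the cell probabilities. -/

namespace Design

variable (S : Design)

lemma t_pos {j : ℕ} (hj : j ∈ Set.Icc 1 S.L) : 0 < S.t j := by
  have := S.t_strictMonoOn (a := 0) (b := j) ⟨le_rfl, Nat.zero_le _⟩ ⟨Nat.zero_le _, hj.2⟩ hj.1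
  rwa [S.t_zero] at this

lemma τ_pos {i : ℕ} (hi : i ∈ Set.Icc 1 S.k) : 0 < S.τ i := by
  obtain ⟨j, hj, h⟩ := S.τ_mem_grid i hi
  exact h ▸ S.t_pos hj

lemma level_zero : S.level 0 = 1 := by
  have : (Finset.Ico 1 S.k).filter (fun i => S.τ i < 0) = ∅ := by
    refine Finset.filter_eq_empty_iff.2 fun i hi => ?_
    rw [Finset.mem_Ico] at hi
    exact not_lt.2 (S.τ_pos ⟨hi.1, hi.2.le⟩).le
  simp [level, this]

/-- Since `τ` increases, the change times before `s` form an initial segment, so their number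
determines which ones they are. -/
lemma τ_lt_iff_lt_level {s : ℝ} {i : ℕ} (hi : i ∈ Finset.Ico 1 S.k) :
    S.τ i < s ↔ i < S.level s := by
  have hi' := Finset.mem_Ico.1 hi
  constructor
  · intro h
    have hsub : Finset.Icc 1 i ⊆ (Finset.Ico 1 S.k).filter (fun i => S.τ i < s) := by
      intro l hl
      rw [Finset.mem_Icc] at hl
      refine Finset.mem_filter.2 ⟨Finset.mem_Ico.2 ⟨hl.1, by omega⟩, lt_of_le_of_lt ?_ h⟩
      exact S.τ_strictMonoOn.monotoneOn ⟨hl.1, by omega⟩ ⟨hi'.1, hi'.2.le⟩ hl.2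
    have := Finset.card_le_card hsub
    simp only [Nat.card_Icc] at this
    unfold level
    omega
  · intro h
    by_contra hn
    have hsub : (Finset.Ico 1 S.k).filter (fun i => S.τ i < s) ⊆ Finset.Ico 1 i := by
      intro l hl
      rw [Finset.mem_filter, Finset.mem_Ico] at hl
      refine Finset.mem_Ico.2 ⟨hl.1.1, ?_⟩
      by_contra hil
      have := S.τ_strictMonoOn.monotoneOn ⟨hi'.1, hi'.2.le⟩ ⟨hl.1.1, hl.1.2.le⟩ (not_lt.1 hil)
      exact hn (this.trans_lt hl.2)
    have := Finset.card_le_card hsub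
    simp only [Nat.card_Ico] at this
    unfold level at h
    omega

lemma level_le (s : ℝ) : S.level s ≤ S.k := by
  have := Finset.card_filter_le (Finset.Ico 1 S.k) (fun i => S.τ i < s)
  have h1 := S.one_le_k
  simp only [Nat.card_Ico] at this
  unfold level
  omega

lemma filter_τ_lt (s : ℝ) :
    (Finset.Ico 1 S.k).filter (fun i => S.τ i < s) = Finset.Ico 1 (S.level s) := by
  ext i
  rw [Finset.mem_filter]
  constructor
  · rintro ⟨hi, h⟩
    exact Finset.mem_Ico.2 ⟨(Finset.mem_Ico.1 hi).1, (S.τ_lt_iff_lt_level hi).1 h⟩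
  · intro h
    rw [Finset.mem_Ico] at h
    have hi : i ∈ Finset.Ico 1 S.k := Finset.mem_Ico.2 ⟨h.1, h.2.trans_le (S.level_le s)⟩
    exact ⟨hi, (S.τ_lt_iff_lt_level hi).2 h.2⟩

lemma level_sub_one_add_one (s : ℝ) : S.level s - 1 + 1 = S.level s := by
  simp [level, add_comm]

/-- The reciprocal `1 / λ_i` of the scale parameter. -/
noncomputable def rate (θ : Param) (i : ℕ) : ℝ := Real.exp (-(θ 0 + θ 1 * S.x i))

lemma scale_pos (θ : Param) (i : ℕ) : 0 < S.scale θ i := Real.exp_pos _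

lemma rate_pos (θ : Param) (i : ℕ) : 0 < S.rate θ i := Real.exp_pos _

lemma inv_scale (θ : Param) (i : ℕ) : (S.scale θ i)⁻¹ = S.rate θ i := by
  rw [scale, rate, Real.exp_neg]

lemma div_scale (θ : Param) (i : ℕ) (a : ℝ) : a / S.scale θ i = a * S.rate θ i := by
  rw [div_eq_mul_inv, inv_scale]

lemma scale_mul_rate (θ : Param) (i : ℕ) : S.scale θ i * S.rate θ i = 1 := by
  rw [← inv_scale, mul_inv_cancel₀ (S.scale_pos θ i).ne']

lemma rate_lt_rate {θ : Param} (hθ : θ ∈ paramSpace) {i : ℕ} (hi : i ∈ Finset.Ico 1 S.k) :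
    S.rate θ i < S.rate θ (i + 1) := by
  rw [Finset.mem_Ico] at hi
  have := S.x_strictMonoOn (a := i) (b := i + 1) ⟨hi.1, hi.2.le⟩ ⟨by omega, hi.2⟩ (by omega)
  refine Real.exp_lt_exp.2 ?_
  nlinarith [mul_pos_of_neg_of_neg hθ.1 (sub_neg.2 this)]

/-- The relation defining `h_i` reads `h_i / λ_{i+1} - h_{i-1} / λ_i = τ_i (1 / λ_i - 1 / λ_{i+1})`,
and these differences telescope. The exposure thus becomes linear in the rates, and the recursion
never has to be differentiated. -/
lemma shift_mul_rate (θ : Param) (n : ℕ) :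
    S.shift θ n * S.rate θ (n + 1) =
      ∑ l ∈ Finset.Icc 1 n, S.τ l * (S.rate θ l - S.rate θ (l + 1)) := by
  induction n with
  | zero => simp [shift]
  | succ n ih =>
    rw [Finset.sum_Icc_succ_top (by omega), ← ih, shift, div_scale]
    linear_combination S.rate θ (n + 1) * (S.τ (n + 1) + S.shift θ n) *
      S.scale_mul_rate θ (n + 2)

/-- The cumulative exposure `(s + h_{i-1}) / λ_i` at time `s`. -/
noncomputable def exposure (θ : Param) (s : ℝ) : ℝ :=
  S.shiftedTime θ s / S.scale θ (S.level s)

lemma exposure_eq (θ : Param) (s : ℝ) :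
    S.exposure θ s = s * S.rate θ (S.level s) +
      ∑ l ∈ Finset.Icc 1 (S.level s - 1), S.τ l * (S.rate θ l - S.rate θ (l + 1)) := by
  rw [exposure, shiftedTime, div_scale, ← shift_mul_rate, level_sub_one_add_one, add_mul]

/-- Summation by parts. In this form monotonicity in `s` is visible without a case distinction on
levels: the rates increase when `a₁ < 0`, so every kink has a positive coefficient. -/
lemma exposure_eq_sum_max (θ : Param) (s : ℝ) :
    S.exposure θ s = s * S.rate θ 1 +
      ∑ l ∈ Finset.Ico 1 S.k, max (s - S.τ l) 0 * (S.rate θ (l + 1) - S.rate θ l) := by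
  have key : ∀ n : ℕ, s * S.rate θ (n + 1) +
      ∑ l ∈ Finset.Icc 1 n, S.τ l * (S.rate θ l - S.rate θ (l + 1)) =
      s * S.rate θ 1 + ∑ l ∈ Finset.Icc 1 n, (s - S.τ l) * (S.rate θ (l + 1) - S.rate θ l) := by
    intro n
    induction n with
    | zero => simp
    | succ n ih =>
      rw [Finset.sum_Icc_succ_top (by omega), Finset.sum_Icc_succ_top (by omega)]
      linear_combination ih
  have h := key (S.level s - 1)
  rw [level_sub_one_add_one] at h
  rw [exposure_eq, h]
  congr 1
  have hI : Finset.Icc 1 (S.level s - 1) = Finset.Ico 1 (S.level s) := by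
    ext i
    have := S.level_sub_one_add_one s
    simp only [Finset.mem_Icc, Finset.mem_Ico]
    omega
  rw [hI, ← filter_τ_lt, Finset.sum_filter]
  refine Finset.sum_congr rfl fun l _ => ?_
  split_ifs with hl
  · rw [max_eq_left (sub_pos.2 hl).le]
  · rw [max_eq_right (sub_nonpos.2 (not_lt.1 hl)), zero_mul]

lemma exposure_strictMono {θ : Param} (hθ : θ ∈ paramSpace) : StrictMono (S.exposure θ) := by
  intro s s' h
  rw [exposure_eq_sum_max, exposure_eq_sum_max]
  refine add_lt_add_of_lt_of_le (mul_lt_mul_of_pos_right h (S.rate_pos θ 1)) ?_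
  refine Finset.sum_le_sum fun l hl => ?_
  refine mul_le_mul_of_nonneg_right (max_le_max (by linarith) le_rfl) ?_
  exact (sub_pos.2 (S.rate_lt_rate hθ hl)).le

lemma exposure_zero (θ : Param) : S.exposure θ 0 = 0 := by
  simp [exposure_eq, level_zero]

lemma exposure_pos {θ : Param} (hθ : θ ∈ paramSpace) {s : ℝ} (hs : 0 < s) :
    0 < S.exposure θ s :=
  S.exposure_zero θ ▸ S.exposure_strictMono hθ hs

lemma lifetimeCDF_eq (θ : Param) (s : ℝ) :
    S.lifetimeCDF θ s = 1 - Real.exp (-S.exposure θ s ^ θ 2) := rfl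

lemma lifetimeCDF_zero {θ : Param} (hθ : θ ∈ paramSpace) : S.lifetimeCDF θ 0 = 0 := by
  rw [lifetimeCDF_eq, exposure_zero, Real.zero_rpow hθ.2.ne']
  simp

lemma lifetimeCDF_lt {θ : Param} (hθ : θ ∈ paramSpace) {s s' : ℝ} (hs : 0 ≤ s) (h : s < s') :
    S.lifetimeCDF θ s < S.lifetimeCDF θ s' := by
  rw [lifetimeCDF_eq, lifetimeCDF_eq]
  have h0 : 0 ≤ S.exposure θ s := S.exposure_zero θ ▸ (S.exposure_strictMono hθ).monotone hs
  have := Real.rpow_lt_rpow h0 (S.exposure_strictMono hθ h) hθ.2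
  linarith [Real.exp_lt_exp.2 (neg_lt_neg this)]

lemma cellProb_pos {θ : Param} (hθ : θ ∈ paramSpace) (j : Fin (S.L + 1)) :
    0 < S.cellProb θ j := by
  rw [cellProb]
  split_ifs with hj
  · refine sub_pos.2 (S.lifetimeCDF_lt hθ ?_ ?_)
    · rcases Nat.eq_zero_or_pos (j : ℕ) with h | h
      · rw [h, S.t_zero]
      · exact (S.t_pos ⟨h, hj.le⟩).le
    · exact S.t_strictMonoOn ⟨Nat.zero_le _, hj.le⟩ ⟨Nat.zero_le _, hj⟩ (Nat.lt_succ_self _)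
  · rw [lifetimeCDF_eq, sub_sub_cancel]
    exact Real.exp_pos _

lemma sum_cellProb {θ : Param} (hθ : θ ∈ paramSpace) : ∑ j, S.cellProb θ j = 1 := by
  rw [Fin.sum_univ_castSucc]
  have : ∀ j : Fin S.L, S.cellProb θ j.castSucc =
      S.lifetimeCDF θ (S.t (j + 1)) - S.lifetimeCDF θ (S.t j) := by
    intro j
    simp [cellProb]
  simp only [this]
  rw [Fin.sum_univ_eq_sum_range
    (fun j => S.lifetimeCDF θ (S.t (j + 1)) - S.lifetimeCDF θ (S.t j)),
    Finset.sum_range_sub (fun j => S.lifetimeCDF θ (S.t j)), S.t_zero, S.lifetimeCDF_zero hθ]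
  simp [cellProb]

lemma hasStrictFDerivAt_rate (θ : Param) (i : ℕ) :
    HasStrictFDerivAt (fun θ => S.rate θ i) (gradCLM ![-S.rate θ i, -S.x i * S.rate θ i, 0]) θ := by
  have h0 : HasStrictFDerivAt (fun θ : Param => θ 0) (EuclideanSpace.proj 0 : Param →L[ℝ] ℝ) θ :=
    (EuclideanSpace.proj 0 : Param →L[ℝ] ℝ).hasStrictFDerivAt
  have h1 : HasStrictFDerivAt (fun θ : Param => θ 1) (EuclideanSpace.proj 1 : Param →L[ℝ] ℝ) θ :=
    (EuclideanSpace.proj 1 : Param →L[ℝ] ℝ).hasStrictFDerivAt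
  refine (h0.add (h1.mul_const (S.x i))).neg.exp.congr_fderiv ?_
  ext v
  simp [gradCLM_apply, Fin.sum_univ_three, rate]
  ring

/-- The partial derivative of the cumulative exposure with respect to `a₁`. -/
noncomputable def exposureDeriv (θ : Param) (s : ℝ) : ℝ :=
  -s * S.x (S.level s) * S.rate θ (S.level s) +
    ∑ l ∈ Finset.Icc 1 (S.level s - 1),
      S.τ l * (S.x (l + 1) * S.rate θ (l + 1) - S.x l * S.rate θ l)

/-- Every rate carries the factor `exp (-a₀)`, so differentiating in `a₀` multiplies the exposure by
`-1`; the shape `η` does not enter. -/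
lemma hasStrictFDerivAt_exposure (θ : Param) (s : ℝ) :
    HasStrictFDerivAt (fun θ => S.exposure θ s)
      (gradCLM ![-S.exposure θ s, S.exposureDeriv θ s, 0]) θ := by
  have h := ((S.hasStrictFDerivAt_rate θ (S.level s)).const_mul s).add
    (HasStrictFDerivAt.fun_sum (u := Finset.Icc 1 (S.level s - 1)) fun l _ =>
      ((S.hasStrictFDerivAt_rate θ l).sub (S.hasStrictFDerivAt_rate θ (l + 1))).const_mul (S.τ l))
  have h' := h.congr_fderiv (g' := gradCLM ![-S.exposure θ s, S.exposureDeriv θ s, 0]) (by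
    ext v
    simp only [add_apply, smul_apply,
      sum_apply, sub_apply, gradCLM_apply,
      Fin.sum_univ_three, Matrix.cons_val_zero, Matrix.cons_val_one, Matrix.cons_val, smul_eq_mul,
      exposure_eq, exposureDeriv, neg_add, add_mul, Finset.sum_mul, ← Finset.sum_neg_distrib]
    rw [show ∀ a b c d e : ℝ, a + b + (c + d) + e = (a + c + e) + (b + d) by intros; ring,
      ← Finset.sum_add_distrib]
    congr 1
    · ring
    · exact Finset.sum_congr rfl fun l _ => by ring)
  refine h'.congr_of_eventuallyEq (Eventually.of_forall fun θ' => ?_)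
  simp [exposure_eq]

/-- The chain rule for `1 - exp (-E ^ η)`, with `E` the exposure; this identifies the explicit `z_j`
as gradients. -/
lemma hasStrictFDerivAt_lifetimeCDF {θ : Param} (hθ : θ ∈ paramSpace) {j : ℕ} (hj : j ≤ S.L) :
    HasStrictFDerivAt (fun θ => S.lifetimeCDF θ (S.t j)) (gradCLM (S.zVec θ j)) θ := by
  rcases Nat.eq_zero_or_pos j with rfl | hj0
  · have h0 : gradCLM (S.zVec θ 0) = 0 := by
      ext v
      simp [gradCLM_apply, zVec]
    rw [h0]
    -- `F_T(0) = 0` fails at `η = 0`, where `0 ^ 0 = 1`; constancy is used only on the open set `Θ`.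
    refine (hasStrictFDerivAt_const (0 : ℝ) θ).congr_of_eventuallyEq ?_
    filter_upwards [isOpen_paramSpace.mem_nhds hθ] with θ' hθ'
    rw [S.t_zero, S.lifetimeCDF_zero hθ']
  · set s := S.t j with hs
    have hE := S.exposure_pos hθ (S.t_pos ⟨hj0, hj⟩)
    rw [← hs] at hE
    have h2 : HasStrictFDerivAt (fun θ : Param => θ 2) (EuclideanSpace.proj 2 : Param →L[ℝ] ℝ) θ :=
      (EuclideanSpace.proj 2 : Param →L[ℝ] ℝ).hasStrictFDerivAt
    have h := (((S.hasStrictFDerivAt_exposure θ s).rpow h2 hE).neg.exp).const_sub 1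
    refine h.congr_fderiv ?_
    have hst : S.shiftedTime θ s = S.exposure θ s * S.scale θ (S.level s) := by
      rw [exposure, div_mul_cancel₀ _ (S.scale_pos θ _).ne']
    have hsr := S.scale_mul_rate θ (S.level s)
    have hpow : S.exposure θ s ^ θ 2 = S.exposure θ s ^ (θ 2 - 1) * S.exposure θ s := by
      rw [Real.rpow_sub_one hE.ne', div_mul_cancel₀ _ hE.ne']
    -- The role of `h*`: it makes this coordinate `λ_i` times the derivative of the exposure in
    -- `a₁`.
    have hz1 : -S.shiftedTime θ s * S.x (S.level s) + S.shiftStar θ (S.level s - 1) =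
        S.scale θ (S.level s) * S.exposureDeriv θ s := by
      rw [shiftStar, level_sub_one_add_one, shiftedTime, exposureDeriv, mul_add]
      have : ∑ l ∈ Finset.Icc 1 (S.level s - 1),
          (S.x (l + 1) / S.scale θ (l + 1) - S.x l / S.scale θ l) * S.τ l =
          ∑ l ∈ Finset.Icc 1 (S.level s - 1),
            S.τ l * (S.x (l + 1) * S.rate θ (l + 1) - S.x l * S.rate θ l) :=
        Finset.sum_congr rfl fun l _ => by rw [div_scale, div_scale]; ring
      rw [this]
      linear_combination s * S.x (S.level s) * hsr
    have hη : θ 2 ≠ 0 := hθ.2.ne'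
    ext v
    rw [gradCLM_apply, zVec, if_pos ⟨hj0, hj⟩, ← hs, hz1]
    rw [show S.lifetimeDensity θ s = θ 2 * S.rate θ (S.level s) * S.exposure θ s ^ (θ 2 - 1) *
      Real.exp (-S.exposure θ s ^ θ 2) by rw [lifetimeDensity, ← exposure, div_scale]]
    rw [← exposure, hst]
    simp only [add_apply, smul_apply,
      neg_apply, gradCLM_apply,
      Fin.sum_univ_three, Matrix.cons_val_zero, Matrix.cons_val_one, Matrix.cons_val, smul_eq_mul,
      Pi.smul_apply, PiLp.proj_apply]
    generalize Real.exp (-S.exposure θ s ^ θ 2) = e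
    rw [hpow]
    generalize S.exposure θ s ^ (θ 2 - 1) = p at *
    field_simp
    linear_combination (-(e * p * θ 2 * S.exposure θ s * v 0) + e * p * θ 2 *
      S.exposureDeriv θ s * v 1 + e * p * S.exposure θ s * Real.log (S.exposure θ s) * v 2) * -hsr

lemma hasStrictFDerivAt_cellProb_apply {θ : Param} (hθ : θ ∈ paramSpace) (j : Fin (S.L + 1)) :
    HasStrictFDerivAt (fun θ => S.cellProb θ j) (gradCLM (S.matW θ j)) θ := by
  have hgr : gradCLM (S.matW θ j) = gradCLM (S.zVec θ (j + 1)) - gradCLM (S.zVec θ j) := by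
    ext v
    simp [gradCLM_apply, matW, sub_mul, Finset.sum_sub_distrib]
  rw [hgr]
  by_cases hj : (j : ℕ) < S.L
  · simp only [cellProb, if_pos hj]
    exact (S.hasStrictFDerivAt_lifetimeCDF hθ hj).sub (S.hasStrictFDerivAt_lifetimeCDF hθ hj.le)
  · simp only [cellProb, if_neg hj]
    have hjL : (j : ℕ) = S.L := by omega
    rw [hjL]
    have h0 : gradCLM (S.zVec θ (S.L + 1)) = 0 := by
      ext v
      simp [gradCLM_apply, zVec]
    rw [h0, zero_sub]
    exact (S.hasStrictFDerivAt_lifetimeCDF hθ le_rfl).const_sub 1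

lemma continuousAt_cellProb {θ : Param} (hθ : θ ∈ paramSpace) : ContinuousAt S.cellProb θ :=
  continuousAt_pi.2 fun j => (S.hasStrictFDerivAt_cellProb_apply hθ j).continuousAt

lemma continuous_scale (i : ℕ) : Continuous fun θ => S.scale θ i := by
  unfold scale
  fun_prop

lemma continuous_shift (i : ℕ) : Continuous fun θ => S.shift θ i := by
  induction i with
  | zero => simp only [shift]; fun_prop
  | succ i ih =>
    simp only [shift]
    exact (((S.continuous_scale _).div (S.continuous_scale _)
      fun θ => (S.scale_pos θ _).ne').mul (continuous_const.add ih)).sub continuous_const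

lemma continuous_shiftStar (i : ℕ) : Continuous fun θ => S.shiftStar θ i := by
  unfold shiftStar
  have h1 := S.continuous_shift i
  have h2 := S.continuous_scale
  refine (h1.mul continuous_const).add ((h2 _).mul (continuous_finsetSum _ fun l _ => ?_))
  exact ((continuous_const.div (h2 _) fun θ => (S.scale_pos θ _).ne').sub
    (continuous_const.div (h2 _) fun θ => (S.scale_pos θ _).ne')).mul continuous_const

lemma continuous_shiftedTime (s : ℝ) : Continuous fun θ => S.shiftedTime θ s :=
  continuous_const.add (S.continuous_shift _)

lemma continuousAt_zVec {θ : Param} (hθ : θ ∈ paramSpace) (j : ℕ) :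
    ContinuousAt (fun θ => S.zVec θ j) θ := by
  unfold zVec
  split_ifs with hj
  · have hE : 0 < S.shiftedTime θ (S.t j) / S.scale θ (S.level (S.t j)) :=
      S.exposure_pos hθ (S.t_pos hj)
    have hη : θ 2 ≠ 0 := hθ.2.ne'
    have hst : ContinuousAt (fun θ => S.shiftedTime θ (S.t j)) θ :=
      (S.continuous_shiftedTime _).continuousAt
    have hsc : ContinuousAt (fun θ => S.scale θ (S.level (S.t j))) θ :=
      (S.continuous_scale _).continuousAt
    have hss : ContinuousAt (fun θ => S.shiftStar θ (S.level (S.t j) - 1)) θ :=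
      (S.continuous_shiftStar _).continuousAt
    have h2 : ContinuousAt (fun θ : Param => θ 2) θ := by fun_prop
    have hsc0 := (S.scale_pos θ (S.level (S.t j))).ne'
    have hq := hst.div hsc hsc0
    have hd : ContinuousAt (fun θ => S.lifetimeDensity θ (S.t j)) θ := by
      unfold lifetimeDensity
      exact ((h2.div hsc hsc0).mul (hq.rpow (h2.sub continuousAt_const) (Or.inl hE.ne'))).mul
        (hq.rpow h2 (Or.inl hE.ne')).neg.rexp
    refine hd.smul (continuousAt_pi.2 fun a => ?_)
    fin_cases a
    · exact hst.neg
    · exact (hst.neg.mul continuousAt_const).add hss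
    · exact (hq.log hE.ne').mul (hst.div h2 hη)
  · exact continuousAt_const

lemma continuousAt_matW {θ : Param} (hθ : θ ∈ paramSpace) : ContinuousAt S.matW θ := by
  refine continuousAt_pi.2 fun j => ?_
  exact (S.continuousAt_zVec hθ (j + 1)).sub (S.continuousAt_zVec hθ j)

lemma continuousAt_matD {θ : Param} (hθ : θ ∈ paramSpace) (s : ℝ) :
    ContinuousAt (fun θ => S.matD θ s) θ := by
  have h : ContinuousAt (fun θ j => S.cellProb θ j ^ s) θ :=
    continuousAt_pi.2 fun j =>
      (continuousAt_pi.1 (S.continuousAt_cellProb hθ) j).rpow_const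
        (Or.inl (S.cellProb_pos hθ j).ne')
  have hd : Continuous (Matrix.diagonal : (Fin (S.L + 1) → ℝ) → Matrix _ _ ℝ) :=
    continuous_id.matrix_diagonal
  exact ContinuousAt.comp (f := fun θ j => S.cellProb θ j ^ s) hd.continuousAt h

/-- The infinitesimal form of `∑ π_j = 1`. It cancels the additive constant in the derivative of the
Kullback-Leibler summands. -/
lemma sum_matW (θ : Param) (a : Fin 3) : ∑ j, S.matW θ j a = 0 := by
  simp only [matW, Matrix.of_apply, Pi.sub_apply]
  rw [Fin.sum_univ_eq_sum_range (fun j => S.zVec θ (j + 1) a - S.zVec θ j a),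
    Finset.sum_range_sub (fun j => S.zVec θ j a)]
  simp [zVec]

end Design

/-! ### The density power divergence. -/

section Divergence

variable {d : ℕ}

/-- One summand of the density power divergence `dpd`. -/
noncomputable def dpdTerm (β p q : ℝ) : ℝ :=
  if β = 0 then p * Real.log (p / q)
  else q ^ (1 + β) - (1 + 1 / β) * p * q ^ β + 1 / β * p ^ (β + 1)

lemma dpd_eq_sum (β : ℝ) (p q : Fin d → ℝ) : dpd β p q = ∑ j, dpdTerm β (p j) (q j) := by
  unfold dpd dpdTerm
  split_ifs <;> rfl

lemma dpdTerm_self {β p : ℝ} (hp : 0 < p) : dpdTerm β p p = 0 := by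
  unfold dpdTerm
  split_ifs with h
  · simp [hp.ne']
  · rw [add_comm 1 β, Real.rpow_add_one hp.ne']
    field_simp
    ring

/-- For `β > 0` each summand is itself positive, by the strict Bernoulli inequality with exponent `1
+ β` at `p / q - 1`. For `β = 0` it only exceeds `p - q`, by `log x < x - 1`; these differences
cancel on summation over probability vectors. -/
lemma sub_lt_dpdTerm {β p q : ℝ} (hβ : 0 ≤ β) (hp : 0 < p) (hq : 0 < q) (hpq : p ≠ q) :
    (if β = 0 then p - q else 0) < dpdTerm β p q := by
  unfold dpdTerm
  split_ifs with h
  · have hne : q / p ≠ 1 := fun h => hpq ((div_eq_one_iff_eq hp.ne').1 h).symm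
    have := Real.log_lt_sub_one_of_pos (div_pos hq hp) hne
    rw [← inv_div q p, Real.log_inv]
    have h2 : p * Real.log (q / p) < p * (q / p - 1) := mul_lt_mul_of_pos_left this hp
    have h3 : p * (q / p - 1) = q - p := by field_simp
    linarith
  · have hβ' : 0 < β := lt_of_le_of_ne hβ (Ne.symm h)
    have hs : p / q - 1 ≠ 0 := fun h => hpq ((div_eq_one_iff_eq hq.ne').1 (by linarith))
    have hb := one_add_mul_self_lt_rpow_one_add (s := p / q - 1) (p := 1 + β)
      (by linarith [div_pos hp hq]) hs (by linarith)
    rw [add_sub_cancel, Real.div_rpow hp.le hq.le, lt_div_iff₀ (Real.rpow_pos_of_pos hq _)] at hb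
    rw [add_comm β 1]
    have hq1 : q ^ (1 + β) = q * q ^ β := by rw [Real.rpow_add hq, Real.rpow_one]
    have h1 : (1 + (1 + β) * (p / q - 1)) * q ^ (1 + β) =
        (1 + β) * p * q ^ β - β * q ^ (1 + β) := by
      rw [hq1]; field_simp; ring
    rw [h1] at hb
    have h2 : q ^ (1 + β) - (1 + 1 / β) * p * q ^ β + 1 / β * p ^ (1 + β) =
        (p ^ (1 + β) - ((1 + β) * p * q ^ β - β * q ^ (1 + β))) / β := by
      field_simp; ring
    rw [h2]
    exact div_pos (by linarith) hβ'

lemma dpd_self {β : ℝ} {p : Fin d → ℝ} (hp : ∀ j, 0 < p j) : dpd β p p = 0 := by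
  rw [dpd_eq_sum]
  exact Finset.sum_eq_zero fun j _ => dpdTerm_self (hp j)

/-- The density power divergence separates probability vectors with positive entries. -/
lemma dpd_pos {β : ℝ} (hβ : 0 ≤ β) {p q : Fin d → ℝ} (hp : ∀ j, 0 < p j) (hq : ∀ j, 0 < q j)
    (hpq : ∑ j, p j = ∑ j, q j) (hne : p ≠ q) : 0 < dpd β p q := by
  obtain ⟨i, hi⟩ := Function.ne_iff.1 hne
  have hsum : ∑ j, (if β = 0 then p j - q j else 0) = 0 := by
    split_ifs
    · rw [Finset.sum_sub_distrib, hpq, sub_self]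
    · simp
  rw [dpd_eq_sum, ← hsum]
  refine Finset.sum_lt_sum (fun j _ => ?_) ⟨i, Finset.mem_univ _, sub_lt_dpdTerm hβ (hp i) (hq i) hi⟩
  rcases eq_or_ne (p j) (q j) with h | h
  · rw [← h, dpdTerm_self (hp j)]
    simp
  · exact (sub_lt_dpdTerm hβ (hp j) (hq j) h).le

lemma continuousAt_dpd {X : Type*} [TopologicalSpace X] {β : ℝ} {p q : X → Fin d → ℝ}
    {x : X} (hp : ContinuousAt p x) (hq : ContinuousAt q x) (hpx : ∀ j, 0 < p x j)
    (hqx : ∀ j, 0 < q x j) : ContinuousAt (fun x => dpd β (p x) (q x)) x := by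
  simp only [dpd_eq_sum]
  refine tendsto_finsetSum _ fun j _ => ?_
  have hp' : ContinuousAt (fun x => p x j) x := continuousAt_pi.1 hp j
  have hq' : ContinuousAt (fun x => q x j) x := continuousAt_pi.1 hq j
  change ContinuousAt (fun x => dpdTerm β (p x j) (q x j)) x
  unfold dpdTerm
  split_ifs with h
  · exact hp'.mul ((hp'.div hq' (hqx j).ne').log (div_pos (hpx j) (hqx j)).ne')
  · exact ((hq'.rpow_const (Or.inl (hqx j).ne')).sub ((continuousAt_const.mul hp').mul
      (hq'.rpow_const (Or.inl (hqx j).ne')))).add (continuousAt_const.mul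
        (hp'.rpow_const (Or.inl (hpx j).ne')))

lemma hasStrictDerivAt_dpdTerm {β p q : ℝ} (hq : 0 < q) :
    HasStrictDerivAt (fun q => dpdTerm β p q)
      (-(1 + β) * (q ^ (β - 1) * (p - q)) - if β = 0 then 1 else 0) q := by
  unfold dpdTerm
  split_ifs with h
  -- An empty cell puts the logarithm at its singularity, but its summand vanishes identically.
  · rcases eq_or_ne p 0 with rfl | hp
    · simp only [zero_mul]
      convert! hasStrictDerivAt_const q (0 : ℝ) using 1
      rw [h, zero_sub, Real.rpow_neg_one]
      field_simp
      ring
    · have h1 : HasStrictDerivAt (fun q => p / q) (-p / q ^ 2) q := by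
        have := (hasStrictDerivAt_const q p).div (hasStrictDerivAt_id q) hq.ne'
        convert! this using 1
        simp
      convert! (h1.log (div_ne_zero hp hq.ne')).const_mul p using 1
      rw [h, zero_sub, Real.rpow_neg_one]
      field_simp
      ring
  · have h1 := (Real.hasStrictDerivAt_rpow_const (x := q) (p := 1 + β) (Or.inl hq.ne'))
    have h2 := (Real.hasStrictDerivAt_rpow_const (x := q) (p := β) (Or.inl hq.ne')).const_mul
      ((1 + 1 / β) * p)
    convert! (h1.sub h2).add_const (1 / β * p ^ (β + 1)) using 1
    have hb : q ^ β = q ^ (β - 1) * q := by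
      rw [Real.rpow_sub_one hq.ne', div_mul_cancel₀ _ hq.ne']
    rw [add_sub_cancel_left, hb]
    field_simp
    ring

end Divergence

/-! ### Lagrange multipliers and existence of roots near the true parameter. -/

lemma matM_mulVec_apply {r : ℕ} (m : Param → EuclideanSpace ℝ (Fin r)) (θ : Param)
    (l : Fin r → ℝ) (a : Fin 3) :
    (matM m θ).mulVec l a = ∑ b, l b * fderiv ℝ m θ (EuclideanSpace.single a 1) b := by
  simp [Matrix.mulVec, dotProduct, matM, mul_comm]

lemma matM_mulVec_injective {r : ℕ} {m : Param → EuclideanSpace ℝ (Fin r)} {θ : Param}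
    (h : (matM m θ).rank = r) : Function.Injective (matM m θ).mulVec := by
  rw [Matrix.mulVec_injective_iff, linearIndependent_iff_card_eq_finrank_span, Set.finrank,
    ← Matrix.rank_eq_finrank_span_cols, h, Fintype.card_fin]

lemma hasStrictFDerivAt_of_contDiffOn {r : ℕ} {m : Param → EuclideanSpace ℝ (Fin r)}
    (hm : ContDiffOn ℝ 1 m paramSpace) {θ : Param} (hθ : θ ∈ paramSpace) :
    HasStrictFDerivAt m (fderiv ℝ m θ) θ :=
  (hm.contDiffAt (isOpen_paramSpace.mem_nhds hθ)).hasStrictFDerivAt one_ne_zero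

namespace Design

variable (S : Design) {r : ℕ}

lemma score_apply (β : ℝ) (p : Fin (S.L + 1) → ℝ) (θ : Param) (a : Fin 3) :
    S.score β p θ a =
      ∑ j, S.matW θ j a * (S.cellProb θ j ^ (β - 1) * (p j - S.cellProb θ j)) := by
  simp [score, matD, Matrix.mulVec, dotProduct, mul_assoc]

lemma hasStrictFDerivAt_dpd {β : ℝ} (p : Fin (S.L + 1) → ℝ) {θ : Param} (hθ : θ ∈ paramSpace) :
    HasStrictFDerivAt (fun θ => dpd β p (S.cellProb θ))
      (-(1 + β) • gradCLM (S.score β p θ)) θ := by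
  simp only [dpd_eq_sum]
  have h := HasStrictFDerivAt.fun_sum (u := Finset.univ) fun j _ =>
    (hasStrictDerivAt_dpdTerm (β := β) (p := p j) (S.cellProb_pos hθ j)).comp_hasStrictFDerivAt θ
      (S.hasStrictFDerivAt_cellProb_apply hθ j)
  refine h.congr_fderiv ?_
  ext v
  have h0 : ∑ j, (if β = 0 then (1 : ℝ) else 0) * gradCLM (S.matW θ j) v = 0 := by
    rw [← Finset.mul_sum]
    simp only [gradCLM_apply]
    rw [Finset.sum_comm]
    simp only [← Finset.sum_mul, sum_matW]
    simp
  simp only [sum_apply, smul_apply, smul_eq_mul, sub_mul, Finset.sum_sub_distrib, h0, sub_zero]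
  simp only [gradCLM_apply, score_apply, Finset.mul_sum, Finset.sum_mul]
  rw [Finset.sum_comm]
  exact Finset.sum_congr rfl fun a _ => Finset.sum_congr rfl fun j _ => by ring

/-- The multiplier rule applied to the coordinates of `m`. Intersecting the level set with `Θ` is
unnecessary, since `Θ` is open and the minimum is local. -/
lemma isRoot_of_isLocalMinOn {β : ℝ} (hβ : 0 ≤ β) {m : Param → EuclideanSpace ℝ (Fin r)}
    (hm : ContDiffOn ℝ 1 m paramSpace) (hM : ∀ θ ∈ paramSpace, (matM m θ).rank = r)
    {p : Fin (S.L + 1) → ℝ} {θ : Param} (hθ : θ ∈ paramSpace) (hmθ : m θ = 0)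
    (hmin : IsLocalMinOn (fun θ => dpd β p (S.cellProb θ)) {θ' | m θ' = m θ} θ) :
    S.IsRoot β m p θ := by
  refine ⟨hθ, ?_, hmθ⟩
  have hset : {θ' | m θ' = m θ} = {θ' | ∀ b, m θ' b = m θ b} := by
    ext θ'
    exact ⟨fun h b => congrArg (fun y : EuclideanSpace ℝ (Fin r) => y b) h, fun h => PiLp.ext h⟩
  rw [hset] at hmin
  have hm' := hasStrictFDerivAt_of_contDiffOn hm hθ
  obtain ⟨l, c, hne, hl⟩ := IsLocalExtrOn.exists_multipliers_of_hasStrictFDerivAt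
    (f := fun b θ => m θ b) (Or.inl hmin)
    (fun b => (EuclideanSpace.proj b : EuclideanSpace ℝ (Fin r) →L[ℝ] ℝ).hasStrictFDerivAt.comp θ
      hm') (S.hasStrictFDerivAt_dpd p hθ)
  have hcoord : (matM m θ).mulVec l = (c * (1 + β)) • S.score β p θ := by
    ext a
    have := DFunLike.congr_fun hl (EuclideanSpace.single a 1)
    simp only [add_apply, sum_apply, smul_apply, smul_eq_mul, gradCLM_apply,
      ContinuousLinearMap.comp_apply, PiLp.proj_apply, zero_apply, PiLp.single_apply] at this
    simp only [mul_ite, mul_one, mul_zero, Finset.sum_ite_eq', Finset.mem_univ, if_true] at this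
    rw [matM_mulVec_apply, Pi.smul_apply, smul_eq_mul]
    linear_combination this
  -- If the objective had multiplier zero, independence of the columns of `M` would make all
  -- multipliers vanish.
  have hc : c ≠ 0 := by
    rintro rfl
    rw [zero_mul, zero_smul] at hcoord
    exact hne (Prod.ext (matM_mulVec_injective (hM θ hθ) (hcoord.trans (Matrix.mulVec_zero _).symm))
      rfl)
  have hcβ : c * (1 + β) ≠ 0 := mul_ne_zero hc (by linarith)
  refine ⟨-(c * (1 + β))⁻¹ • l, ?_⟩
  rw [Matrix.mulVec_smul, hcoord, smul_smul, neg_mul, inv_mul_cancel₀ hcβ, neg_one_smul,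
    add_neg_cancel]

lemma IsRMDPDE.isRoot {S : Design} {β : ℝ} (hβ : 0 ≤ β) {m : Param → EuclideanSpace ℝ (Fin r)}
    (hm : ContDiffOn ℝ 1 m paramSpace) (hM : ∀ θ ∈ paramSpace, (matM m θ).rank = r)
    {p : Fin (S.L + 1) → ℝ} {θ : Param} (h : S.IsRMDPDE β m p θ) : S.IsRoot β m p θ := by
  refine S.isRoot_of_isLocalMinOn hβ hm hM h.1.1 h.1.2 ?_
  filter_upwards [self_mem_nhdsWithin,
    mem_nhdsWithin_of_mem_nhds (isOpen_paramSpace.mem_nhds h.1.1)] with θ' hθ' hΘ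
  exact h.2 θ' hΘ (hθ'.trans h.1.2)

lemma matW_mulVec_injective {β : ℝ} {θ : Param} (hJ : IsUnit (S.matJ β θ)) :
    Function.Injective (S.matW θ).mulVec := by
  have h := Matrix.mulVec_injective_of_isUnit hJ
  refine Function.Injective.of_comp (f := ((S.matW θ).transpose * S.matD θ (β - 1)).mulVec) ?_
  have : ((S.matW θ).transpose * S.matD θ (β - 1)).mulVec ∘ (S.matW θ).mulVec =
      (S.matJ β θ).mulVec := by
    ext v
    simp [matJ, Matrix.mulVec_mulVec]
  rwa [this]

/-- The derivative of the vector of cell probabilities, with matrix `W`. -/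
noncomputable def cellProbDeriv (θ : Param) : Param →L[ℝ] (Fin (S.L + 1) → ℝ) :=
  ContinuousLinearMap.pi fun j => gradCLM (S.matW θ j)

lemma cellProbDeriv_apply (θ v : Param) : S.cellProbDeriv θ v = (S.matW θ).mulVec v := by
  ext j
  simp [cellProbDeriv, gradCLM_apply, Matrix.mulVec, dotProduct]

lemma hasStrictFDerivAt_cellProb {θ : Param} (hθ : θ ∈ paramSpace) :
    HasStrictFDerivAt S.cellProb (S.cellProbDeriv θ) θ :=
  hasStrictFDerivAt_pi.2 fun j => S.hasStrictFDerivAt_cellProb_apply hθ j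

/-- Local identifiability: an injective derivative in finite dimension is bounded below, so `π`
cannot return to `π(θ₀)` nearby. -/
lemma eventually_cellProb_ne {β : ℝ} {θ₀ : Param} (hθ₀ : θ₀ ∈ paramSpace)
    (hJ : IsUnit (S.matJ β θ₀)) : ∀ᶠ θ in 𝓝 θ₀, θ ≠ θ₀ → S.cellProb θ ≠ S.cellProb θ₀ := by
  have hinj : Function.Injective (S.cellProbDeriv θ₀) := by
    intro u v huv
    rw [cellProbDeriv_apply, cellProbDeriv_apply] at huv
    exact PiLp.ext (congrFun (S.matW_mulVec_injective hJ huv))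
  have hanti : ∃ C, AntilipschitzWith C (S.cellProbDeriv θ₀) := by
    obtain ⟨C, -, hC⟩ := (S.cellProbDeriv θ₀).toLinearMap.exists_antilipschitzWith
      (LinearMap.ker_eq_bot.2 hinj)
    exact ⟨C, hC⟩
  exact eventually_nhdsWithin_iff.1
    ((S.hasStrictFDerivAt_cellProb hθ₀).hasFDerivAt.eventually_ne hanti)

/-- Close to `π(θ₀)`, the restricted estimating equations have a root close to `θ₀`. -/
lemma eventually_exists_isRoot {β : ℝ} (hβ : 0 ≤ β) {m : Param → EuclideanSpace ℝ (Fin r)}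
    (hm : ContDiffOn ℝ 1 m paramSpace) (hM : ∀ θ ∈ paramSpace, (matM m θ).rank = r)
    {θ₀ : Param} (hθ₀ : θ₀ ∈ paramSpace) (hmθ₀ : m θ₀ = 0) (hJ : IsUnit (S.matJ β θ₀))
    {ε : ℝ} (hε : 0 < ε) :
    ∀ᶠ p in 𝓝 (S.cellProb θ₀), ∃ θ, dist θ θ₀ < ε ∧ S.IsRoot β m p θ := by
  obtain ⟨δ, hδ, hball⟩ := Metric.eventually_nhds_iff_ball.1
    ((isOpen_paramSpace.eventually_mem hθ₀).and (S.eventually_cellProb_ne hθ₀ hJ))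
  set ρ := min (δ / 2) (ε / 2) with hρ
  have hρ0 : 0 < ρ := lt_min (by linarith) (by linarith)
  have hin : ∀ θ ∈ Metric.closedBall θ₀ ρ, θ ∈ Metric.ball θ₀ δ := fun θ hθ =>
    Metric.mem_ball.2 ((Metric.mem_closedBall.1 hθ).trans_lt
      ((min_le_left _ _).trans_lt (by linarith)))
  have hcm : ContinuousOn m (Metric.closedBall θ₀ ρ) :=
    hm.continuousOn.mono fun θ hθ => (hball θ (hin θ hθ)).1
  have hclosed : IsClosed (Metric.closedBall θ₀ ρ ∩ m ⁻¹' {0}) :=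
    hcm.preimage_isClosed_of_isClosed Metric.isClosed_closedBall isClosed_singleton
  have hK : IsCompact (Metric.closedBall θ₀ ρ ∩ m ⁻¹' {0}) :=
    (isCompact_closedBall θ₀ ρ).of_isClosed_subset hclosed Set.inter_subset_left
  have hK' : IsCompact ((Metric.closedBall θ₀ ρ ∩ m ⁻¹' {0}) ∩ Metric.sphere θ₀ ρ) :=
    hK.inter_right Metric.isClosed_sphere
  have hπ0 := S.cellProb_pos hθ₀
  -- At `p = π(θ₀)` the left side is zero and the right side positive; continuity in `(p, θ)` and
  -- compactness extend this to nearby `p`, uniformly over the constrained sphere.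
  have hsep : ∀ᶠ p in 𝓝 (S.cellProb θ₀),
      ∀ θ ∈ (Metric.closedBall θ₀ ρ ∩ m ⁻¹' {0}) ∩ Metric.sphere θ₀ ρ,
        dpd β p (S.cellProb θ₀) < dpd β p (S.cellProb θ) := by
    refine hK'.eventually_forall_of_forall_eventually fun θ hθ => ?_
    have hθb := hball θ (hin θ hθ.1.1)
    have hne : θ ≠ θ₀ := by
      rintro rfl
      have := Metric.mem_sphere.1 hθ.2
      rw [dist_self] at this
      exact hρ0.ne this
    have hc1 : ContinuousAt (fun z : (Fin (S.L + 1) → ℝ) × Param => dpd β z.1 (S.cellProb θ₀))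
        (S.cellProb θ₀, θ) :=
      continuousAt_dpd continuousAt_fst continuousAt_const hπ0 hπ0
    have hc2 : ContinuousAt (fun z : (Fin (S.L + 1) → ℝ) × Param => dpd β z.1 (S.cellProb z.2))
        (S.cellProb θ₀, θ) :=
      continuousAt_dpd continuousAt_fst
        (ContinuousAt.comp (f := Prod.snd) (S.continuousAt_cellProb hθb.1) continuousAt_snd) hπ0
        (S.cellProb_pos hθb.1)
    refine hc1.eventually_lt hc2 ?_
    change dpd β (S.cellProb θ₀) (S.cellProb θ₀) < dpd β (S.cellProb θ₀) (S.cellProb θ)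
    rw [dpd_self hπ0]
    exact dpd_pos hβ hπ0 (S.cellProb_pos hθb.1)
      ((S.sum_cellProb hθ₀).trans (S.sum_cellProb hθb.1).symm) (hθb.2 hne).symm
  filter_upwards [hsep] with p hp
  have hcont : ContinuousOn (fun θ => dpd β p (S.cellProb θ))
      (Metric.closedBall θ₀ ρ ∩ m ⁻¹' {0}) := fun θ hθ =>
    (S.hasStrictFDerivAt_dpd p (hball θ (hin θ hθ.1)).1).continuousAt.continuousWithinAt
  obtain ⟨θ, hθ, hmin⟩ := hK.exists_isMinOn
    ⟨θ₀, Metric.mem_closedBall_self hρ0.le, hmθ₀⟩ hcont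
  -- On the sphere the minimizer would be beaten by `θ₀`, so it is interior.
  have hlt : dist θ θ₀ < ρ := by
    refine lt_of_le_of_ne (Metric.mem_closedBall.1 hθ.1) fun h => ?_
    exact (hp θ ⟨hθ, h⟩).not_ge (hmin ⟨Metric.mem_closedBall_self hρ0.le, hmθ₀⟩)
  refine ⟨θ, hlt.trans ((min_le_right _ _).trans_lt (by linarith)),
    S.isRoot_of_isLocalMinOn hβ hm hM (hball θ (hin θ hθ.1)).1 hθ.2 ?_⟩
  filter_upwards [self_mem_nhdsWithin,
    mem_nhdsWithin_of_mem_nhds (Metric.isOpen_ball.mem_nhds hlt)] with θ' hθ' hb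
  exact hmin ⟨Metric.ball_subset_closedBall hb, Eq.trans hθ' hθ.2⟩

end Design

/-- A relation has a selection whose values are, up to `η`, as close to `x₀` as possible. -/
lemma exists_nearest_selection {V E : Type*} [PseudoMetricSpace E] (R : V → E → Prop) (x₀ : E)
    {η : ℝ} (hη : 0 < η) : ∃ g : V → E, ∀ p ε, (∃ x, dist x x₀ < ε ∧ R p x) →
      R p (g p) ∧ dist (g p) x₀ < ε + η := by
  have key : ∀ p, ∃ y, ∀ ε, (∃ x, dist x x₀ < ε ∧ R p x) → R p y ∧ dist y x₀ < ε + η := by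
    intro p
    by_cases h : ∃ x, R p x
    · have hbdd : BddBelow ((fun x => dist x x₀) '' {x | R p x}) :=
        ⟨0, by rintro _ ⟨x, -, rfl⟩; exact dist_nonneg⟩
      obtain ⟨_, ⟨y, hy, rfl⟩, hlt⟩ := Real.lt_sInf_add_pos
        (s := (fun x => dist x x₀) '' {x | R p x}) (Set.Nonempty.image _ h) hη
      refine ⟨y, ?_⟩
      rintro ε ⟨x, hx, hR⟩
      have := csInf_le hbdd ⟨x, hR, rfl⟩
      exact ⟨hy, by linarith⟩
    · exact ⟨x₀, fun ε ⟨x, _, hR⟩ => (h ⟨x, hR⟩).elim⟩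
  choose g hg using key
  exact ⟨g, hg⟩

/-! ### First-order expansion of the roots. -/

/-- First-order expansion of the solutions of the equations `B(x)(p - π(x)) = 0`, `m(x) = 0`. -/
lemma eventually_norm_sub_sub_le {E V F : Type*} [NormedAddCommGroup E] [NormedSpace ℝ E]
    [NormedAddCommGroup V] [NormedSpace ℝ V] [NormedAddCommGroup F] [NormedSpace ℝ F]
    {B : E → V →L[ℝ] E} {π : E → V} {m : E → F} {x₀ : E} {W : E →L[ℝ] V} {M : E →L[ℝ] F}
    {Q : F →L[ℝ] E} (hB : ContinuousAt B x₀) (hπ : HasFDerivAt π W x₀) (hm : HasFDerivAt m M x₀)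
    (hm₀ : m x₀ = 0) (hid : ∀ u, B x₀ (W u) = u - Q (M u)) {ε : ℝ} (hε : 0 < ε) :
    ∀ᶠ x in 𝓝 x₀, ∀ p, B x (p - π x) = 0 → m x = 0 →
      ‖x - x₀ - B x₀ (p - π x₀)‖ ≤ ε * ‖p - π x₀‖ := by
  set b := ‖B x₀‖ with hb
  set C := ‖Q‖ + b + ‖W‖ + 1 with hC
  have hb0 : 0 ≤ b := norm_nonneg _
  have hC1 : 1 ≤ C := by have := norm_nonneg Q; have := norm_nonneg W; linarith
  -- The bound `e * C ≤ 1 / 2` allows `‖u‖` to be absorbed on the left; the last bound is what the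
  -- final estimate requires.
  obtain ⟨e, he0, he1, heC, heε⟩ : ∃ e : ℝ, 0 < e ∧ e ≤ 1 ∧ e * C ≤ 1 / 2 ∧
      e * (1 + C * (2 * (b + 1))) ≤ ε := by
    refine ⟨min (min 1 (1 / (2 * C))) (ε / (1 + C * (2 * (b + 1)))), by positivity, ?_, ?_, ?_⟩
    · exact (min_le_left _ _).trans (min_le_left _ _)
    · have : min (min 1 (1 / (2 * C))) (ε / (1 + C * (2 * (b + 1)))) ≤ 1 / (2 * C) :=
        (min_le_left _ _).trans (min_le_right _ _)
      calc _ ≤ 1 / (2 * C) * C := by gcongr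
        _ = 1 / 2 := by field_simp
    · rw [← le_div_iff₀ (by positivity)]
      exact min_le_right _ _
  have h1 : ∀ᶠ x in 𝓝 x₀, ‖B x - B x₀‖ ≤ e := by
    filter_upwards [hB.eventually (Metric.closedBall_mem_nhds (B x₀) he0)] with x hx
    rwa [← dist_eq_norm]
  have h2 := hπ.isLittleO.bound he0
  have h3 := hm.isLittleO.bound he0
  filter_upwards [h1, h2, h3] with x hx1 hx2 hx3 p hp hmx
  set u := x - x₀ with hu
  set v := p - π x₀ with hv
  set w := π x - π x₀ with hw
  have hpw : p - π x = v - w := by rw [hv, hw]; abel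
  rw [hpw] at hp
  -- Both points satisfy the constraint, so `M u` itself is of smaller order than `u`.
  rw [hmx, hm₀, sub_zero, zero_sub, norm_neg] at hx3
  -- Substitute `B x v = B x w` and `u = B x₀ (W u) + Q (M u)`; every term on the right then has a
  -- small factor.
  have hdec : u - B x₀ v = (B x - B x₀) v + Q (M u) - B x₀ (w - W u) - (B x - B x₀) w := by
    have h4 := hid u
    rw [map_sub] at hp
    simp only [sub_apply, map_sub, h4]
    rw [sub_eq_zero.1 hp]
    abel
  have hw' : ‖w‖ ≤ (‖W‖ + 1) * ‖u‖ := by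
    calc ‖w‖ = ‖(w - W u) + W u‖ := by rw [sub_add_cancel]
      _ ≤ ‖w - W u‖ + ‖W u‖ := norm_add_le _ _
      _ ≤ e * ‖u‖ + ‖W‖ * ‖u‖ := add_le_add hx2 (W.le_opNorm u)
      _ ≤ (‖W‖ + 1) * ‖u‖ := by nlinarith [norm_nonneg u]
  have hmain : ‖u - B x₀ v‖ ≤ e * ‖v‖ + e * C * ‖u‖ := by
    rw [hdec]
    have a1 : ‖(B x - B x₀) v‖ ≤ e * ‖v‖ := ContinuousLinearMap.le_of_opNorm_le _ hx1 v
    have a2 : ‖Q (M u)‖ ≤ ‖Q‖ * (e * ‖u‖) :=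
      (Q.le_opNorm _).trans (mul_le_mul_of_nonneg_left hx3 (norm_nonneg _))
    have a3 : ‖B x₀ (w - W u)‖ ≤ b * (e * ‖u‖) :=
      ((B x₀).le_opNorm _).trans (mul_le_mul_of_nonneg_left hx2 (norm_nonneg _))
    have a4 : ‖(B x - B x₀) w‖ ≤ e * ((‖W‖ + 1) * ‖u‖) :=
      (ContinuousLinearMap.le_of_opNorm_le _ hx1 w).trans (mul_le_mul_of_nonneg_left hw' he0.le)
    calc _ ≤ ‖(B x - B x₀) v‖ + ‖Q (M u)‖ + ‖B x₀ (w - W u)‖ + ‖(B x - B x₀) w‖ :=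
          (norm_sub_le _ _).trans (add_le_add_left ((norm_sub_le _ _).trans
            (add_le_add_left (norm_add_le _ _) _)) _)
      _ ≤ e * ‖v‖ + ‖Q‖ * (e * ‖u‖) + b * (e * ‖u‖) + e * ((‖W‖ + 1) * ‖u‖) := by gcongr
      _ = _ := by rw [hC]; ring
  -- The a priori rate, which turns errors relative to `‖u‖` into errors relative to `‖v‖`.
  have hu' : ‖u‖ ≤ 2 * (b + 1) * ‖v‖ := by
    have a1 : ‖u‖ ≤ ‖B x₀ v‖ + ‖u - B x₀ v‖ := by
      simpa using norm_add_le (B x₀ v) (u - B x₀ v)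
    have a2 : ‖B x₀ v‖ ≤ b * ‖v‖ := (B x₀).le_opNorm v
    nlinarith [norm_nonneg u, norm_nonneg v]
  calc ‖u - B x₀ v‖ ≤ e * ‖v‖ + e * C * ‖u‖ := hmain
    _ ≤ e * ‖v‖ + e * C * (2 * (b + 1) * ‖v‖) := by gcongr
    _ = e * (1 + C * (2 * (b + 1))) * ‖v‖ := by ring
    _ ≤ ε * ‖v‖ := by gcongr

lemma _root_.ContinuousAt.matrix_mul {X : Type*} [TopologicalSpace X] {a b c : ℕ}
    {A : X → Matrix (Fin a) (Fin b) ℝ} {B : X → Matrix (Fin b) (Fin c) ℝ} {x : X}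
    (hA : ContinuousAt A x) (hB : ContinuousAt B x) : ContinuousAt (fun x => A x * B x) x := by
  have h : Continuous fun z : Matrix (Fin a) (Fin b) ℝ × Matrix (Fin b) (Fin c) ℝ => z.1 * z.2 :=
    continuous_fst.matrix_mul continuous_snd
  exact ContinuousAt.comp (f := fun x => (A x, B x)) h.continuousAt (hA.prodMk hB)

lemma _root_.ContinuousAt.matrix_transpose {X : Type*} [TopologicalSpace X] {a b : ℕ}
    {A : X → Matrix (Fin a) (Fin b) ℝ} {x : X} (hA : ContinuousAt A x) :
    ContinuousAt (fun x => (A x).transpose) x := by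
  have h : Continuous fun A : Matrix (Fin a) (Fin b) ℝ => A.transpose :=
    continuous_id.matrix_transpose
  exact ContinuousAt.comp (f := A) h.continuousAt hA

/-- The continuous linear map with matrix `A`, with values in the Euclidean space. -/
noncomputable def mulVecCLM {a b : ℕ} :
    Matrix (Fin a) (Fin b) ℝ →L[ℝ] (Fin b → ℝ) →L[ℝ] EuclideanSpace ℝ (Fin a) :=
  LinearMap.toContinuousLinearMap
    { toFun := fun A => LinearMap.toContinuousLinearMap
        ((WithLp.linearEquiv 2 ℝ (Fin a → ℝ)).symm.toLinearMap ∘ₗ A.mulVecLin)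
      map_add' := fun A B => by ext; simp
      map_smul' := fun c A => by ext; simp }

lemma mulVecCLM_apply {a b : ℕ} (A : Matrix (Fin a) (Fin b) ℝ) (v : Fin b → ℝ) :
    mulVecCLM A v = WithLp.toLp 2 (A.mulVec v) := rfl

lemma fderiv_eq_matM_mulVec {r : ℕ} (m : Param → EuclideanSpace ℝ (Fin r)) (θ v : Param) :
    WithLp.ofLp (fderiv ℝ m θ v) = (matM m θ).transpose.mulVec v := by
  have hv : v = ∑ a, v a • EuclideanSpace.single a (1 : ℝ) := by
    ext b
    simp [Finset.sum_apply, Pi.single_apply]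
  ext b
  conv_lhs => rw [hv]
  simp [Matrix.mulVec, dotProduct, matM, mul_comm, Finset.sum_apply]

lemma continuousAt_matM {r : ℕ} {m : Param → EuclideanSpace ℝ (Fin r)}
    (hm : ContDiffOn ℝ 1 m paramSpace) {θ : Param} (hθ : θ ∈ paramSpace) :
    ContinuousAt (matM m) θ := by
  have h : ContinuousAt (fderiv ℝ m) θ :=
    (hm.contDiffAt (isOpen_paramSpace.mem_nhds hθ)).continuousAt_fderiv one_ne_zero
  refine continuousAt_pi.2 fun a => continuousAt_pi.2 fun b => ?_
  exact (EuclideanSpace.proj b : EuclideanSpace ℝ (Fin r) →L[ℝ] ℝ).continuous.continuousAt.comp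
    (h.clm_apply continuousAt_const)

namespace Design

variable (S : Design) {r : ℕ}

lemma transpose_matD (θ : Param) (s : ℝ) : (S.matD θ s).transpose = S.matD θ s := by
  simp [matD]

lemma posSemidef_matJ (β : ℝ) {θ : Param} (hθ : θ ∈ paramSpace) : (S.matJ β θ).PosSemidef := by
  have h : (S.matD θ (β - 1)).PosSemidef :=
    Matrix.PosSemidef.diagonal fun j => (Real.rpow_pos_of_pos (S.cellProb_pos hθ j) _).le
  simpa [matJ] using h.conjTranspose_mul_mul_same (S.matW θ)

lemma posDef_matJ {β : ℝ} {θ : Param} (hθ : θ ∈ paramSpace) (hJ : IsUnit (S.matJ β θ)) :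
    (S.matJ β θ).PosDef :=
  (S.posSemidef_matJ β hθ).posDef_iff_isUnit.2 hJ

lemma isUnit_transpose_mul_mul {J : Matrix (Fin 3) (Fin 3) ℝ} (hJ : J.PosDef)
    {M : Matrix (Fin 3) (Fin r) ℝ} (hM : Function.Injective M.mulVec) :
    IsUnit (M.transpose * J⁻¹ * M) := by
  have := hJ.inv.conjTranspose_mul_mul_same hM
  simpa using this.isUnit

/-- The matrix `J⁻¹ - J⁻¹ M (Mᵀ J⁻¹ M)⁻¹ Mᵀ J⁻¹`. -/
noncomputable def projMat (J : Matrix (Fin 3) (Fin 3) ℝ) (M : Matrix (Fin 3) (Fin r) ℝ) :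
    Matrix (Fin 3) (Fin 3) ℝ :=
  J⁻¹ - J⁻¹ * M * (M.transpose * J⁻¹ * M)⁻¹ * M.transpose * J⁻¹

lemma projMat_mul_self {J : Matrix (Fin 3) (Fin 3) ℝ} (hJ : J.PosDef)
    {M : Matrix (Fin 3) (Fin r) ℝ} (hM : Function.Injective M.mulVec) : projMat J M * M = 0 := by
  have h := (Matrix.isUnit_iff_isUnit_det _).1 (isUnit_transpose_mul_mul hJ hM)
  have : J⁻¹ * M * (M.transpose * J⁻¹ * M)⁻¹ * M.transpose * J⁻¹ * M =
      J⁻¹ * M * ((M.transpose * J⁻¹ * M)⁻¹ * (M.transpose * J⁻¹ * M)) := by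
    simp only [Matrix.mul_assoc]
  rw [projMat, Matrix.sub_mul, this, Matrix.nonsing_inv_mul _ h, Matrix.mul_one, sub_self]

lemma continuousAt_projMat {J : Matrix (Fin 3) (Fin 3) ℝ} (hJ : J.PosDef)
    {M : Param → Matrix (Fin 3) (Fin r) ℝ} {θ : Param} (hM : Function.Injective (M θ).mulVec)
    (hc : ContinuousAt M θ) : ContinuousAt (fun θ => projMat J (M θ)) θ := by
  have hJc : ContinuousAt (fun _ : Param => J⁻¹) θ := continuousAt_const
  have hT := ContinuousAt.matrix_transpose hc
  have hG := (hT.matrix_mul hJc).matrix_mul hc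
  have hdet := (Matrix.isUnit_iff_isUnit_det _).1 (isUnit_transpose_mul_mul hJ hM)
  have hI : ContinuousAt (fun θ => ((M θ).transpose * J⁻¹ * M θ)⁻¹) θ := by
    refine ContinuousAt.comp (f := fun θ => (M θ).transpose * J⁻¹ * M θ)
      (continuousAt_matrix_inv _ ?_) hG
    rw [Ring.inverse_eq_inv']
    exact continuousAt_inv₀ hdet.ne_zero
  exact hJc.sub ((((hJc.matrix_mul hc).matrix_mul hI).matrix_mul hT).matrix_mul hJc)

/-- The matrix `P_β Wᵀ D_π^{β-1}` of the linear map that sends the deviations of the relative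
frequencies to the leading term of the deviation of the estimator. -/
noncomputable def influence (β : ℝ) (m : Param → EuclideanSpace ℝ (Fin r)) (θ : Param) :
    Matrix (Fin 3) (Fin (S.L + 1)) ℝ :=
  S.matP β m θ * ((S.matW θ).transpose * S.matD θ (β - 1))

/-- The multiplier is eliminated because `projMat J (matM m θ)` kills the columns of `M(θ)`. The
matrix `J` need not depend on `θ`; it is later frozen at `J_β(θ₀)`. -/
lemma IsRoot.projMat_mulVec_eq_zero {S : Design} {β : ℝ} {m : Param → EuclideanSpace ℝ (Fin r)}
    {J : Matrix (Fin 3) (Fin 3) ℝ} (hJ : J.PosDef) (hM : ∀ θ ∈ paramSpace, (matM m θ).rank = r)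
    {p : Fin (S.L + 1) → ℝ} {θ : Param} (h : S.IsRoot β m p θ) :
    (projMat J (matM m θ) * ((S.matW θ).transpose * S.matD θ (β - 1))).mulVec
      (p - S.cellProb θ) = 0 := by
  obtain ⟨hθ, ⟨l, hl⟩, -⟩ := h
  have h2 := congrArg (projMat J (matM m θ)).mulVec hl
  rw [Matrix.mulVec_add, Matrix.mulVec_mulVec,
    projMat_mul_self hJ (matM_mulVec_injective (hM θ hθ)), Matrix.zero_mulVec, add_zero,
    Matrix.mulVec_zero, score, Matrix.mulVec_mulVec] at h2
  exact h2

/-- Supplies the hypothesis `hid` of `eventually_norm_sub_sub_le`: the influence matrix inverts `W`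
up to a term that factors through the derivative of `m`. -/
lemma matP_mul_matJ {β : ℝ} (m : Param → EuclideanSpace ℝ (Fin r)) {θ : Param}
    (hJ : IsUnit (S.matJ β θ)) :
    S.matP β m θ * S.matJ β θ = 1 - S.matQ β m θ * (matM m θ).transpose := by
  have h := (Matrix.isUnit_iff_isUnit_det _).1 hJ
  rw [matP, Matrix.sub_mul, Matrix.nonsing_inv_mul _ h, Matrix.mul_assoc,
    Matrix.nonsing_inv_mul _ h, Matrix.mul_one]

/-- First-order expansion of the roots of the restricted estimating equations near `θ₀`. -/
lemma eventually_root_expansion {β : ℝ} {m : Param → EuclideanSpace ℝ (Fin r)}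
    (hm : ContDiffOn ℝ 1 m paramSpace) (hM : ∀ θ ∈ paramSpace, (matM m θ).rank = r)
    {θ₀ : Param} (hθ₀ : θ₀ ∈ paramSpace) (hmθ₀ : m θ₀ = 0) (hJ : IsUnit (S.matJ β θ₀))
    {ε : ℝ} (hε : 0 < ε) :
    ∀ᶠ θ in 𝓝 θ₀, ∀ p, S.IsRoot β m p θ →
      ‖θ - θ₀ - mulVecCLM (S.influence β m θ₀) (p - S.cellProb θ₀)‖ ≤
        ε * ‖p - S.cellProb θ₀‖ := by
  have hJ' := S.posDef_matJ hθ₀ hJ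
  have hB : ContinuousAt (fun θ => mulVecCLM (projMat (S.matJ β θ₀) (matM m θ) *
      ((S.matW θ).transpose * S.matD θ (β - 1)))) θ₀ := by
    exact ContinuousAt.comp mulVecCLM.continuous.continuousAt
      ((continuousAt_projMat hJ' (matM_mulVec_injective (hM θ₀ hθ₀))
        (continuousAt_matM hm hθ₀)).matrix_mul
        ((S.continuousAt_matW hθ₀).matrix_transpose.matrix_mul (S.continuousAt_matD hθ₀ _)))
  have hid : ∀ u, mulVecCLM (S.influence β m θ₀) (S.cellProbDeriv θ₀ u) =
      u - (mulVecCLM (S.matQ β m θ₀) ∘L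
        (PiLp.continuousLinearEquiv 2 ℝ (fun _ : Fin r => ℝ)).toContinuousLinearMap)
          (fderiv ℝ m θ₀ u) := by
    intro u
    have h1 : S.influence β m θ₀ * S.matW θ₀ = 1 - S.matQ β m θ₀ * (matM m θ₀).transpose := by
      rw [← S.matP_mul_matJ m hJ, influence, matJ, Matrix.mul_assoc]
    have h2 : (PiLp.continuousLinearEquiv 2 ℝ (fun _ : Fin r => ℝ)) (fderiv ℝ m θ₀ u) =
        (matM m θ₀).transpose.mulVec u := fderiv_eq_matM_mulVec m θ₀ u
    rw [ContinuousLinearMap.comp_apply, ContinuousLinearEquiv.coe_coe, h2, mulVecCLM_apply,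
      mulVecCLM_apply, cellProbDeriv_apply, Matrix.mulVec_mulVec, Matrix.mulVec_mulVec, h1,
      Matrix.sub_mulVec, Matrix.one_mulVec, WithLp.toLp_sub, WithLp.toLp_ofLp]
  filter_upwards [eventually_norm_sub_sub_le hB (S.hasStrictFDerivAt_cellProb hθ₀).hasFDerivAt
    (hasStrictFDerivAt_of_contDiffOn hm hθ₀).hasFDerivAt hmθ₀ hid hε] with θ hθ p hp
  refine hθ p ?_ hp.2.2
  rw [mulVecCLM_apply, hp.projMat_mulVec_eq_zero hJ' hM, WithLp.toLp_zero]

end Design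

/-! ### Limit theorems for multinomial frequencies. -/

lemma tendsto_inv_sqrt_natCast : Tendsto (fun N : ℕ => (√(N : ℝ))⁻¹) atTop (𝓝 0) :=
  tendsto_inv_atTop_zero.comp (Real.tendsto_sqrt_atTop.comp tendsto_natCast_atTop_atTop)

lemma isLittleO_exp_taylor_two (a : ℝ) :
    (fun N : ℕ => Complex.exp (Complex.I * a * ((√(N : ℝ))⁻¹ : ℝ)) -
      (1 + Complex.I * a * ((√(N : ℝ))⁻¹ : ℝ) - (a : ℂ) ^ 2 / 2 / N)) =o[atTop]
      fun N : ℕ => 1 / (N : ℂ) := by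
  have hx : Tendsto (fun N : ℕ => Complex.I * a * ((√(N : ℝ))⁻¹ : ℝ)) atTop (𝓝 0) := by
    have := (Complex.continuous_ofReal.tendsto 0).comp tendsto_inv_sqrt_natCast
    simpa using this.const_mul (Complex.I * a)
  have h1 := (Complex.exp_sub_sum_range_isBigO_pow 3).comp_tendsto hx
  have hsq : ∀ N : ℕ, (((√(N : ℝ))⁻¹ : ℝ) : ℂ) ^ 2 = 1 / (N : ℂ) := by
    intro N
    rw [← Complex.ofReal_pow, inv_pow, Real.sq_sqrt (Nat.cast_nonneg N)]
    simp
  have h2 : (fun N : ℕ => (Complex.I * a * ((√(N : ℝ))⁻¹ : ℝ)) ^ 3) =o[atTop]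
      fun N : ℕ => 1 / (N : ℂ) := by
    have h3 : (fun N : ℕ => (Complex.I * a) ^ 2 * (Complex.I * a * ((√(N : ℝ))⁻¹ : ℝ)))
        =o[atTop] fun _ : ℕ => (1 : ℂ) := by
      rw [Asymptotics.isLittleO_one_iff]
      simpa using hx.const_mul ((Complex.I * a) ^ 2)
    have h4 := h3.mul_isBigO (Asymptotics.isBigO_refl (fun N : ℕ => 1 / (N : ℂ)) atTop)
    refine h4.congr (fun N => ?_) fun N => one_mul _
    rw [← hsq]
    ring
  refine (h1.trans_isLittleO h2).congr (fun N => ?_) fun N => rfl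
  simp only [Function.comp_apply, Finset.sum_range_succ, Finset.sum_range_zero]
  have := hsq N
  simp only [mul_pow, Complex.I_sq, this, Nat.factorial]
  push_cast
  ring

/-- The characteristic functions of the normalized sums of a centred random variable with finitely
many values converge. -/
lemma tendsto_sum_exp_pow {d : ℕ} {q a : Fin d → ℝ} (hq : ∑ j, q j = 1)
    (ha : ∑ j, q j * a j = 0) :
    Tendsto (fun N : ℕ => (∑ j, (q j : ℂ) *
      Complex.exp (Complex.I * a j * ((√(N : ℝ))⁻¹ : ℝ))) ^ N) atTop
      (𝓝 (Complex.exp (-((∑ j, q j * a j ^ 2 : ℝ) : ℂ) / 2))) := by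
  refine Complex.tendsto_pow_exp_of_isLittleO_sub_add_div _ ?_
  have h := Asymptotics.IsLittleO.sum (s := Finset.univ) fun j _ =>
    (isLittleO_exp_taylor_two (a j)).const_mul_left (q j : ℂ)
  refine h.congr (fun N => ?_) fun N => rfl
  have hq' : ∑ j, (q j : ℂ) = 1 := by exact_mod_cast hq
  have ha' : ∑ j, (q j : ℂ) * a j = 0 := by exact_mod_cast ha
  have e1 : ∑ j, (q j : ℂ) * (1 + Complex.I * a j * ((√(N : ℝ))⁻¹ : ℝ) - (a j : ℂ) ^ 2 / 2 / N) =
      ∑ j, (q j : ℂ) + Complex.I * ((√(N : ℝ))⁻¹ : ℝ) * ∑ j, (q j : ℂ) * a j -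
        (∑ j, (q j : ℂ) * (a j : ℂ) ^ 2) / 2 / N := by
    simp only [Finset.mul_sum, Finset.sum_div, ← Finset.sum_add_distrib,
      ← Finset.sum_sub_distrib]
    exact Finset.sum_congr rfl fun j _ => by ring
  rw [hq', ha'] at e1
  simp only [Finset.sum_apply, mul_sub (q _ : ℂ) (Complex.exp _), Finset.sum_sub_distrib, e1]
  push_cast
  ring

section Multinomial

variable {Ω : Type*} [MeasurableSpace Ω] {d : ℕ} {P : Measure Ω} {n : Ω → Fin d → ℕ} {N : ℕ}
  {q : Fin d → ℝ}

lemma HasMultinomialLaw.integral_eq [IsProbabilityMeasure P] (h : HasMultinomialLaw P n N q)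
    (hq : ∀ j, 0 ≤ q j) (f : (Fin d → ℕ) → ℂ) :
    ∫ ω, f (n ω) ∂P = ∑ c ∈ Finset.piAntidiag Finset.univ N,
      ((Nat.multinomial Finset.univ c * ∏ j, q j ^ c j : ℝ) : ℂ) * f c := by
  have hmeas : ∀ c : Fin d → ℕ, MeasurableSet {ω | n ω = c} := fun c =>
    h.measurable (measurableSet_singleton c)
  have hae : (fun ω => f (n ω)) =ᵐ[P] fun ω => ∑ c ∈ Finset.piAntidiag Finset.univ N,
      Set.indicator {ω | n ω = c} (fun _ => f c) ω := by
    filter_upwards [h.sum_eq] with ω hω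
    rw [Finset.sum_eq_single (n ω)]
    · simp
    · intro c _ hc
      exact Set.indicator_of_notMem (fun h : n ω = c => hc h.symm) _
    · intro hn
      exact (hn (by simpa [Finset.mem_piAntidiag] using hω)).elim
  rw [integral_congr_ae hae, integral_finsetSum]
  · refine Finset.sum_congr rfl fun c hc => ?_
    have hc' : ∑ j, c j = N := (Finset.mem_piAntidiag.1 hc).1
    rw [integral_indicator_const _ (hmeas c), Measure.real, h.prob_eq c hc',
      ENNReal.toReal_ofReal (mul_nonneg (Nat.cast_nonneg _)
        (Finset.prod_nonneg fun j _ => pow_nonneg (hq j) _)), Complex.real_smul]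
  · exact fun c _ => (integrable_const _).indicator (hmeas c)

/-- The multinomial theorem folds the sum over counts into an `N`-th power. As the counts add up to
`N`, subtracting `N q_j` from them amounts to centring `s` at its `q`-mean, which gives the mean
zero required by `tendsto_sum_exp_pow`. -/
lemma HasMultinomialLaw.integral_exp [IsProbabilityMeasure P] (h : HasMultinomialLaw P n N q)
    (hq : ∀ j, 0 ≤ q j) (hN : N ≠ 0) (s : Fin d → ℝ) :
    ∫ ω, Complex.exp (Complex.I * ((√(N : ℝ) * ∑ j, s j * (relFreq N (n ω) j - q j) : ℝ) : ℂ)) ∂P =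
      (∑ j, (q j : ℂ) * Complex.exp (Complex.I * ((s j - ∑ i, q i * s i : ℝ) : ℂ) *
        ((√(N : ℝ))⁻¹ : ℝ))) ^ N := by
  rw [h.integral_eq hq fun c =>
    Complex.exp (Complex.I * ((√(N : ℝ) * ∑ j, s j * (relFreq N c j - q j) : ℝ) : ℂ)),
    Finset.sum_pow_eq_sum_piAntidiag]
  refine Finset.sum_congr rfl fun c hc => ?_
  have hc' : ∑ j, c j = N := (Finset.mem_piAntidiag.1 hc).1
  have hc'' : ∑ j, (c j : ℝ) = N := by exact_mod_cast hc'
  simp only [mul_pow, Finset.prod_mul_distrib, ← Complex.exp_nat_mul, ← Complex.exp_sum]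
  push_cast
  rw [mul_assoc]
  congr 3
  have hreal : √(N : ℝ) * ∑ j, s j * (relFreq N c j - q j) =
      ∑ j, (c j : ℝ) * ((s j - ∑ i, q i * s i) * (√(N : ℝ))⁻¹) := by
    have hN0 : (0 : ℝ) < N := by positivity
    have hs : √(N : ℝ) * √(N : ℝ) = N := Real.mul_self_sqrt hN0.le
    have hs0 : √(N : ℝ) ≠ 0 := (Real.sqrt_pos.2 hN0).ne'
    have e1 : ∑ j, (c j : ℝ) * ((s j - ∑ i, q i * s i) * (√(N : ℝ))⁻¹) =
        (∑ j, s j * c j - (∑ j, (c j : ℝ)) * ∑ i, q i * s i) * (√(N : ℝ))⁻¹ := by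
      rw [Finset.sum_mul, ← Finset.sum_sub_distrib, Finset.sum_mul]
      exact Finset.sum_congr rfl fun j _ => by ring
    have e2 : ∑ j, s j * (relFreq N c j - q j) = (∑ j, s j * c j) / N - ∑ i, q i * s i := by
      rw [Finset.sum_div, ← Finset.sum_sub_distrib]
      exact Finset.sum_congr rfl fun j _ => by rw [relFreq]; ring
    rw [e1, e2, hc'', eq_mul_inv_iff_mul_eq₀ hs0, mul_right_comm, hs]
    field_simp
  have := congrArg (fun x : ℝ => Complex.I * (x : ℂ)) hreal
  push_cast at this
  rw [this, Finset.mul_sum]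
  exact Finset.sum_congr rfl fun j _ => by ring

lemma measurable_relFreq (N : ℕ) : Measurable (relFreq N : (Fin d → ℕ) → Fin d → ℝ) :=
  measurable_of_countable _

end Multinomial

section Limits

variable {Ω : ℕ → Type*} [∀ N, MeasurableSpace (Ω N)] {P : ∀ N, Measure (Ω N)}

lemma norm_exp_I_mul_sub_le (x y : ℝ) :
    ‖Complex.exp (Complex.I * x) - Complex.exp (Complex.I * y)‖ ≤ |x - y| := by
  have : Complex.exp (Complex.I * x) - Complex.exp (Complex.I * y) =
      Complex.exp (Complex.I * y) * (Complex.exp (Complex.I * ((x - y : ℝ) : ℂ)) - 1) := by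
    rw [mul_sub, ← Complex.exp_add, mul_one]
    congr 2
    push_cast
    ring
  rw [this, norm_mul, Complex.norm_exp_I_mul_ofReal, one_mul]
  exact Real.norm_exp_I_mul_ofReal_sub_one_le

/-- Slutsky's lemma for characteristic functions, with varying probability spaces. -/
lemma tendsto_integral_exp_of_sub [∀ N, IsProbabilityMeasure (P N)] {f g : ∀ N, Ω N → ℝ}
    (hf : ∀ N, AEMeasurable (f N) (P N)) (hg : ∀ N, AEMeasurable (g N) (P N))
    (hfg : ∀ ε > 0, Tendsto (fun N => P N {ω | ε ≤ |f N ω - g N ω|}) atTop (𝓝 0)) {z : ℂ}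
    (hz : Tendsto (fun N => ∫ ω, Complex.exp (Complex.I * g N ω) ∂(P N)) atTop (𝓝 z)) :
    Tendsto (fun N => ∫ ω, Complex.exp (Complex.I * f N ω) ∂(P N)) atTop (𝓝 z) := by
  have hint : ∀ {h : ∀ N, Ω N → ℝ}, (∀ N, AEMeasurable (h N) (P N)) → ∀ N,
      Integrable (fun ω => Complex.exp (Complex.I * h N ω)) (P N) := by
    intro h hh N
    refine Integrable.of_bound (C := 1) ?_ (Eventually.of_forall fun ω => ?_)
    · have := hh N
      exact (Complex.measurable_exp.comp_aemeasurable
        ((Complex.measurable_ofReal.comp_aemeasurable this).const_mul _)).aestronglyMeasurable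
    · rw [Complex.norm_exp_I_mul_ofReal]
  suffices h0 : Tendsto (fun N => ∫ ω, Complex.exp (Complex.I * f N ω) ∂(P N) -
      ∫ ω, Complex.exp (Complex.I * g N ω) ∂(P N)) atTop (𝓝 0) by
    simpa using h0.add hz
  have hbound : ∀ ε > 0, ∀ N, ‖∫ ω, Complex.exp (Complex.I * f N ω) ∂(P N) -
      ∫ ω, Complex.exp (Complex.I * g N ω) ∂(P N)‖ ≤
        ε + 2 * (P N).real {ω | ε ≤ |f N ω - g N ω|} := by
    intro ε hε N
    -- The measurable hull has the same measure. The integrand is at most `2` on it and at most `ε`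
    -- off it.
    set A := toMeasurable (P N) {ω | ε ≤ |f N ω - g N ω|} with hA
    have hAm : MeasurableSet A := measurableSet_toMeasurable _ _
    have hAP : (P N).real A = (P N).real {ω | ε ≤ |f N ω - g N ω|} := by
      rw [Measure.real, Measure.real, hA, measure_toMeasurable]
    rw [← integral_sub (hint hf N) (hint hg N)]
    calc _ ≤ ∫ ω, ‖Complex.exp (Complex.I * f N ω) - Complex.exp (Complex.I * g N ω)‖ ∂(P N) :=
          norm_integral_le_integral_norm _
      _ ≤ ∫ ω, (ε + A.indicator (fun _ => (2 : ℝ)) ω) ∂(P N) := by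
          refine integral_mono ((hint hf N).sub (hint hg N)).norm
            ((integrable_const _).add ((integrable_const _).indicator hAm)) fun ω => ?_
          by_cases hω : ε ≤ |f N ω - g N ω|
          · have hωA : ω ∈ A := subset_toMeasurable _ _ hω
            simp only [Set.indicator_of_mem hωA]
            refine (norm_sub_le _ _).trans ?_
            rw [Complex.norm_exp_I_mul_ofReal, Complex.norm_exp_I_mul_ofReal]
            linarith
          · have : 0 ≤ A.indicator (fun _ => (2 : ℝ)) ω :=
              Set.indicator_nonneg (fun _ _ => zero_le_two) ω
            have h2 := norm_exp_I_mul_sub_le (f N ω) (g N ω)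
            simp only
            linarith [not_le.1 hω]
      _ = ε + 2 * (P N).real {ω | ε ≤ |f N ω - g N ω|} := by
          rw [integral_add (integrable_const _) ((integrable_const _).indicator hAm),
            integral_indicator_const _ hAm, hAP]
          simp [mul_comm]
  rw [Metric.tendsto_nhds]
  intro ε hε
  have h1 : Tendsto (fun N => (P N).real {ω | ε / 2 ≤ |f N ω - g N ω|}) atTop (𝓝 0) := by
    have := (ENNReal.tendsto_toReal ENNReal.zero_ne_top).comp (hfg (ε / 2) (by positivity))
    simpa [Function.comp_def, Measure.real] using this
  filter_upwards [h1.eventually (gt_mem_nhds (show (0 : ℝ) < ε / 4 by positivity))] with N hN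
  rw [dist_zero_right]
  have := hbound (ε / 2) (by positivity) N
  linarith

variable {d : ℕ} {n : ∀ N, Ω N → Fin d → ℕ} {q : Fin d → ℝ}

lemma tendsto_integral_exp_multinomial [∀ N, IsProbabilityMeasure (P N)]
    (hn : ∀ N, HasMultinomialLaw (P N) (n N) N q) (hq : ∀ j, 0 ≤ q j) (hq1 : ∑ j, q j = 1)
    (s : Fin d → ℝ) :
    Tendsto (fun N => ∫ ω, Complex.exp (Complex.I *
      ((√(N : ℝ) * ∑ j, s j * (relFreq N (n N ω) j - q j) : ℝ) : ℂ)) ∂(P N)) atTop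
      (𝓝 (Complex.exp (-((∑ j, q j * (s j - ∑ i, q i * s i) ^ 2 : ℝ) : ℂ) / 2))) := by
  have ha : ∑ j, q j * (s j - ∑ i, q i * s i) = 0 := by
    simp only [mul_sub, Finset.sum_sub_distrib]
    rw [← Finset.sum_mul, hq1, one_mul, sub_self]
  refine (tendsto_sum_exp_pow hq1 ha).congr' ?_
  filter_upwards [eventually_ne_atTop 0] with N hN
  rw [(hn N).integral_exp hq hN]

/-- The normalized deviations of multinomial relative frequencies are tight. -/
lemma exists_bound_relFreq [∀ N, IsProbabilityMeasure (P N)]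
    (hn : ∀ N, HasMultinomialLaw (P N) (n N) N q) (hq : ∀ j, 0 ≤ q j) (hq1 : ∑ j, q j = 1)
    {ε : ENNReal} (hε : 0 < ε) :
    ∃ R : ℝ, 0 < R ∧ ∀ N, P N {ω | R < √(N : ℝ) * ‖relFreq N (n N ω) - q‖} ≤ ε := by
  set Z : ∀ N, Ω N → EuclideanSpace ℝ (Fin d) := fun N ω =>
    WithLp.toLp 2 (√(N : ℝ) • (relFreq N (n N ω) - q)) with hZ
  have hZm : ∀ N, Measurable (Z N) := fun N => by
    have := (((measurable_relFreq N).comp (hn N).measurable).sub_const q).const_smul √(N : ℝ)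
    exact (WithLp.measurable_toLp 2 (Fin d → ℝ)).comp this
  have hprob : ∀ N, IsProbabilityMeasure ((P N).map (Z N)) := fun N =>
    Measure.isProbabilityMeasure_map (hZm N).aemeasurable
  have hlim : ∀ t : EuclideanSpace ℝ (Fin d),
      Tendsto (fun N => charFun ((P N).map (Z N)) t) atTop
        (𝓝 (Complex.exp (-((∑ j, q j * (t j - ∑ i, q i * t i) ^ 2 : ℝ) : ℂ) / 2))) := by
    intro t
    refine (tendsto_integral_exp_multinomial hn hq hq1 t).congr fun N => ?_
    rw [charFun_apply, integral_map (hZm N).aemeasurable (by fun_prop)]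
    refine integral_congr_ae (Eventually.of_forall fun ω => ?_)
    have : inner ℝ (Z N ω) t = √(N : ℝ) * ∑ j, t j * (relFreq N (n N ω) j - q j) := by
      simp only [hZ, PiLp.inner_apply, Finset.mul_sum]
      refine Finset.sum_congr rfl fun j _ => ?_
      simp
      ring
    simp only [this]
    rw [mul_comm]
  -- The limit is continuous at the origin, so tightness follows without moment bounds.
  have htight := isTightMeasureSet_of_tendsto_charFun
    (f := fun t : EuclideanSpace ℝ (Fin d) =>
      Complex.exp (-((∑ j, q j * (t j - ∑ i, q i * t i) ^ 2 : ℝ) : ℂ) / 2))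
    (Continuous.continuousAt (by fun_prop)) hlim
  obtain ⟨K, hK, hKε⟩ := isTightMeasureSet_iff_exists_isCompact_measure_compl_le.1 htight ε hε
  obtain ⟨R, hR0, hR⟩ := hK.isBounded.exists_pos_norm_le
  refine ⟨R, hR0, fun N => ?_⟩
  refine le_trans (measure_mono ?_) ((Measure.le_map_apply (hZm N).aemeasurable _).trans
    (hKε _ ⟨N, rfl⟩))
  intro ω hω hωK
  have hlt : R < √(N : ℝ) * ‖relFreq N (n N ω) - q‖ := hω
  refine absurd hlt (not_lt.2 ?_)
  refine le_trans ?_ (hR _ hωK)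
  have h1 : √(N : ℝ) * ‖relFreq N (n N ω) - q‖ = ‖√(N : ℝ) • (relFreq N (n N ω) - q)‖ := by
    rw [norm_smul, Real.norm_of_nonneg (Real.sqrt_nonneg _)]
  rw [h1, pi_norm_le_iff_of_nonneg (norm_nonneg _)]
  exact fun j => PiLp.norm_apply_le (Z N ω) j

/-- The law of large numbers for multinomial relative frequencies. -/
lemma withProbTendstoOne_relFreq [∀ N, IsProbabilityMeasure (P N)]
    (hn : ∀ N, HasMultinomialLaw (P N) (n N) N q) (hq : ∀ j, 0 ≤ q j) (hq1 : ∑ j, q j = 1)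
    {A : (Fin d → ℝ) → Prop} (hA : ∀ᶠ p in 𝓝 q, A p) :
    WithProbTendstoOne P fun N ω => A (relFreq N (n N ω)) := by
  obtain ⟨δ, hδ, hball⟩ := Metric.eventually_nhds_iff.1 hA
  refine ENNReal.tendsto_nhds_zero.2 fun ε hε => ?_
  obtain ⟨R, -, hR⟩ := exists_bound_relFreq hn hq hq1 hε
  -- A deviation of fixed size `δ` then lies in the tail controlled by tightness.
  have hlarge : ∀ᶠ N : ℕ in atTop, R < √(N : ℝ) * δ :=
    ((Real.tendsto_sqrt_atTop.comp tendsto_natCast_atTop_atTop).atTop_mul_const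
      hδ).eventually_gt_atTop R
  filter_upwards [hlarge] with N hN
  refine (measure_mono fun ω hω => ?_).trans (hR N)
  have hle : δ ≤ ‖relFreq N (n N ω) - q‖ := by
    rw [← dist_eq_norm]
    exact not_lt.1 fun h => hω (hball h)
  exact hN.trans_le (mul_le_mul_of_nonneg_left hle (Real.sqrt_nonneg _))

end Limits

/-! ### Identification of the asymptotic covariance. -/

section Covariance

variable {d : ℕ}

/-- The covariance matrix of a single multinomial trial with probability vector `q`. -/
def trialCov (q : Fin d → ℝ) : Matrix (Fin d) (Fin d) ℝ :=
  Matrix.diagonal q - Matrix.vecMulVec q q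

/-- Both sides are the variance of a variable taking the value `s j` with probability `q j`. -/
lemma dotProduct_trialCov_mulVec {q : Fin d → ℝ} (hq : ∑ j, q j = 1) (s : Fin d → ℝ) :
    s ⬝ᵥ (trialCov q).mulVec s = ∑ j, q j * (s j - ∑ i, q i * s i) ^ 2 := by
  set μ := ∑ i, q i * s i with hμ
  have h1 : ∑ j, q j * (s j - μ) ^ 2 = ∑ j, q j * s j ^ 2 - 2 * μ * ∑ j, q j * s j +
      μ ^ 2 * ∑ j, q j := by
    simp only [Finset.mul_sum, ← Finset.sum_sub_distrib, ← Finset.sum_add_distrib]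
    exact Finset.sum_congr rfl fun j _ => by ring
  have h2 : s ⬝ᵥ (trialCov q).mulVec s = ∑ j, q j * s j ^ 2 - μ * ∑ j, q j * s j := by
    simp only [dotProduct, trialCov, Matrix.sub_mulVec, Pi.sub_apply, Matrix.mulVec_diagonal,
      mul_sub, Finset.sum_sub_distrib, Finset.mul_sum]
    congr 1
    · exact Finset.sum_congr rfl fun j _ => by ring
    · refine Finset.sum_congr rfl fun j _ => ?_
      simp only [Matrix.mulVec, dotProduct, Matrix.vecMulVec_apply, hμ, Finset.mul_sum,
        Finset.sum_mul]
      exact Finset.sum_congr rfl fun i _ => by ring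
  rw [h1, h2, hq, ← hμ]
  ring

lemma posSemidef_trialCov {q : Fin d → ℝ} (hq0 : ∀ j, 0 ≤ q j) (hq : ∑ j, q j = 1) :
    (trialCov q).PosSemidef := by
  refine Matrix.PosSemidef.of_dotProduct_mulVec_nonneg ?_ fun s => ?_
  · refine (Matrix.isHermitian_diagonal q).sub ?_
    ext i j
    simp [Matrix.vecMulVec_apply, mul_comm]
  · rw [star_trivial, dotProduct_trialCov_mulVec hq]
    exact Finset.sum_nonneg fun j _ => mul_nonneg (hq0 j) (sq_nonneg _)

end Covariance

namespace Design

variable (S : Design) {r : ℕ}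

/-- Pulling `D_π^{β-1}` out on both sides of the middle factor leaves `D_π - π πᵀ`; thus `K_β` is
the covariance of the score of one trial. -/
lemma matK_eq (β : ℝ) {θ : Param} (hθ : θ ∈ paramSpace) :
    S.matK β θ = ((S.matW θ).transpose * S.matD θ (β - 1)) * trialCov (S.cellProb θ) *
      ((S.matW θ).transpose * S.matD θ (β - 1)).transpose := by
  have h : S.matD θ (2 * β - 1) -
      Matrix.vecMulVec (fun j => S.cellProb θ j ^ β) (fun j => S.cellProb θ j ^ β) =
      S.matD θ (β - 1) * trialCov (S.cellProb θ) * S.matD θ (β - 1) := by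
    ext i j
    have hi := S.cellProb_pos hθ i
    have hb : ∀ j, S.cellProb θ j ^ β = S.cellProb θ j ^ (β - 1) * S.cellProb θ j := fun j => by
      rw [Real.rpow_sub_one (S.cellProb_pos hθ j).ne',
        div_mul_cancel₀ _ (S.cellProb_pos hθ j).ne']
    have hd : S.cellProb θ i ^ (2 * β - 1) =
        S.cellProb θ i ^ (β - 1) * S.cellProb θ i * S.cellProb θ i ^ (β - 1) := by
      rw [← hb, ← Real.rpow_add hi]
      congr 1
      ring
    simp only [matD, trialCov, Matrix.mul_diagonal, Matrix.diagonal_mul, Matrix.sub_apply,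
      Matrix.vecMulVec_apply, Matrix.diagonal_apply]
    split_ifs with hij
    · subst hij
      rw [hd, hb]
      ring
    · rw [hb, hb j]
      ring
  rw [matK, h, Matrix.transpose_mul, Matrix.transpose_transpose, transpose_matD]
  simp only [Matrix.mul_assoc]

lemma matSigma_eq (β : ℝ) (m : Param → EuclideanSpace ℝ (Fin r)) {θ : Param}
    (hθ : θ ∈ paramSpace) :
    S.matSigma β m θ =
      S.influence β m θ * trialCov (S.cellProb θ) * (S.influence β m θ).transpose := by
  rw [matSigma, S.matK_eq β hθ, influence, Matrix.transpose_mul (S.matP β m θ)]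
  simp only [Matrix.mul_assoc]

lemma posSemidef_matSigma (β : ℝ) (m : Param → EuclideanSpace ℝ (Fin r)) {θ : Param}
    (hθ : θ ∈ paramSpace) : (S.matSigma β m θ).PosSemidef := by
  rw [S.matSigma_eq β m hθ]
  simpa using (posSemidef_trialCov (fun j => (S.cellProb_pos hθ j).le)
    (S.sum_cellProb hθ)).mul_mul_conjTranspose_same (S.influence β m θ)

lemma dotProduct_matSigma_mulVec (β : ℝ) (m : Param → EuclideanSpace ℝ (Fin r)) {θ : Param}
    (hθ : θ ∈ paramSpace) (t : Fin 3 → ℝ) :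
    t ⬝ᵥ (S.matSigma β m θ).mulVec t =
      ∑ j, S.cellProb θ j * ((S.influence β m θ).transpose.mulVec t j -
        ∑ i, S.cellProb θ i * (S.influence β m θ).transpose.mulVec t i) ^ 2 := by
  rw [← dotProduct_trialCov_mulVec (S.sum_cellProb hθ), S.matSigma_eq β m hθ,
    ← Matrix.mulVec_mulVec, ← Matrix.mulVec_mulVec, Matrix.dotProduct_mulVec,
    Matrix.mulVec_transpose]

end Design

/-! ### Convergence in distribution. -/

section Asymptotics

variable {Ω : ℕ → Type*} [∀ N, MeasurableSpace (Ω N)] {P : ∀ N, Measure (Ω N)}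

lemma WithProbTendstoOne.mono {A B : ∀ N, Ω N → Prop} (h : WithProbTendstoOne P A)
    (hAB : ∀ N ω, A N ω → B N ω) : WithProbTendstoOne P B :=
  tendsto_of_tendsto_of_tendsto_of_le_of_le tendsto_const_nhds h (fun _ => zero_le)
    fun N => measure_mono fun ω hω hA => hω (hAB N ω hA)

lemma WithProbTendstoOne.and {A B : ∀ N, Ω N → Prop} (hA : WithProbTendstoOne P A)
    (hB : WithProbTendstoOne P B) : WithProbTendstoOne P fun N ω => A N ω ∧ B N ω := by
  have h := hA.add hB
  rw [add_zero] at h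
  refine tendsto_of_tendsto_of_tendsto_of_le_of_le tendsto_const_nhds h (fun _ => zero_le)
    fun N => (measure_mono fun ω hω => ?_).trans (measure_union_le _ _)
  exact not_and_or.1 hω

lemma TendstoInProb.withProbTendstoOne {X : ∀ N, Ω N → Param} {θ₀ : Param}
    (h : TendstoInProb P X θ₀) {A : Param → Prop} (hA : ∀ᶠ θ in 𝓝 θ₀, A θ) :
    WithProbTendstoOne P fun N ω => A (X N ω) := by
  obtain ⟨δ, hδ, hball⟩ := Metric.eventually_nhds_iff.1 hA
  refine tendsto_of_tendsto_of_tendsto_of_le_of_le tendsto_const_nhds (h δ hδ) (fun _ => zero_le)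
    fun N => measure_mono fun ω hω => ?_
  exact not_lt.1 fun h => hω (hball h)

/-- A sequence of random vectors with the linear expansion of the roots of the
restricted estimating equations is asymptotically normal. -/
lemma tendstoInDistribution_of_expansion (S : Design) (β : ℝ) {r : ℕ}
    (m : Param → EuclideanSpace ℝ (Fin r)) {θ₀ : Param} (hθ₀ : θ₀ ∈ paramSpace)
    [∀ N, IsProbabilityMeasure (P N)] {n : ∀ N, Ω N → Fin (S.L + 1) → ℕ}
    (hn : ∀ N, HasMultinomialLaw (P N) (n N) N (S.cellProb θ₀))
    {X : ∀ N, Ω N → Param} (hX : ∀ N, AEMeasurable (X N) (P N))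
    (hexp : ∀ ε > 0, WithProbTendstoOne P fun N ω =>
      ‖X N ω - θ₀ - mulVecCLM (S.influence β m θ₀) (relFreq N (n N ω) - S.cellProb θ₀)‖ ≤
        ε * ‖relFreq N (n N ω) - S.cellProb θ₀‖) :
    TendstoInDistribution (fun (N : ℕ) ω => √(N : ℝ) • (X N ω - θ₀)) atTop id P
      (multivariateGaussian 0 (S.matSigma β m θ₀)) := by
  have hq : ∀ j, 0 ≤ S.cellProb θ₀ j := fun j => (S.cellProb_pos hθ₀ j).le
  have hq1 := S.sum_cellProb hθ₀
  have hYm : ∀ N : ℕ, AEMeasurable (fun ω => √(N : ℝ) • (X N ω - θ₀)) (P N) := fun N => by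
    have := ((hX N).sub_const θ₀).const_smul √(N : ℝ)
    exact this
  refine ⟨hYm, aemeasurable_id, ProbabilityMeasure.tendsto_of_tendsto_charFun fun t => ?_⟩
  -- By adjointness, testing the linear term against `t` is testing the frequencies against `s`.
  set s := (S.influence β m θ₀).transpose.mulVec t with hs
  have hlim : charFun ((multivariateGaussian 0 (S.matSigma β m θ₀)).map id) t =
      Complex.exp (-((∑ j, S.cellProb θ₀ j * (s j - ∑ i, S.cellProb θ₀ i * s i) ^ 2 : ℝ) : ℂ) / 2)
      := by
    rw [Measure.map_id, charFun_multivariateGaussian (S.posSemidef_matSigma β m hθ₀),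
      S.dotProduct_matSigma_mulVec β m hθ₀]
    simp only [inner_zero_right, Complex.ofReal_zero, zero_mul, zero_sub, neg_div]
    rfl
  have hgoal : Tendsto (fun N : ℕ => ∫ ω, Complex.exp (Complex.I *
      (inner ℝ (√(N : ℝ) • (X N ω - θ₀)) t : ℝ)) ∂(P N)) atTop
      (𝓝 (charFun ((multivariateGaussian 0 (S.matSigma β m θ₀)).map id) t)) := by
    rw [hlim]
    refine tendsto_integral_exp_of_sub (fun N => (hYm N).inner_const) (fun N => ?_) ?_
      (tendsto_integral_exp_multinomial hn hq hq1 s)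
    · have h1 : Measurable fun ω => relFreq N (n N ω) :=
        (measurable_relFreq N).comp (hn N).measurable
      have h2 : ∀ j, Measurable fun ω => relFreq N (n N ω) j := measurable_pi_iff.1 h1
      exact ((Finset.measurable_sum _ fun j _ =>
        ((h2 j).sub_const _).const_mul (s j)).const_mul _).aemeasurable
    · intro ε hε
      refine ENNReal.tendsto_nhds_zero.2 fun η hη => ?_
      obtain ⟨R, hR0, hR⟩ := exists_bound_relFreq hn hq hq1 (ENNReal.half_pos hη.ne')
      -- With this choice `e * R * (‖t‖ + 1) = ε / 2`; the summand `1` covers `t = 0`.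
      set e := ε / (2 * R * (‖t‖ + 1)) with he
      have he0 : 0 < e := by positivity
      filter_upwards [ENNReal.tendsto_nhds_zero.1 (hexp e he0) (η / 2)
        (ENNReal.half_pos hη.ne')] with N hN
      rw [← ENNReal.add_halves η]
      refine le_trans (measure_mono ?_) ((measure_union_le _ _).trans (add_le_add hN (hR N)))
      intro ω hω
      by_contra hnot
      simp only [Set.mem_union, not_or] at hnot
      have h1 := not_not.1 hnot.1
      have h2 : √(N : ℝ) * ‖relFreq N (n N ω) - S.cellProb θ₀‖ ≤ R := not_lt.1 hnot.2
      set v := relFreq N (n N ω) - S.cellProb θ₀ with hv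
      have hsv : ∑ j, s j * (relFreq N (n N ω) j - S.cellProb θ₀ j) =
          inner ℝ (mulVecCLM (S.influence β m θ₀) v) t := by
        have h3 : inner ℝ (mulVecCLM (S.influence β m θ₀) v) t =
            WithLp.ofLp t ⬝ᵥ (S.influence β m θ₀).mulVec v := by
          simp [mulVecCLM_apply, PiLp.inner_apply, dotProduct]
        rw [h3, Matrix.dotProduct_mulVec, ← Matrix.mulVec_transpose, ← hs]
        rfl
      have hdiff : inner ℝ (√(N : ℝ) • (X N ω - θ₀)) t -
          √(N : ℝ) * ∑ j, s j * (relFreq N (n N ω) j - S.cellProb θ₀ j) =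
          √(N : ℝ) * inner ℝ (X N ω - θ₀ - mulVecCLM (S.influence β m θ₀) v) t := by
        rw [hsv, real_inner_smul_left, inner_sub_left (X N ω - θ₀), mul_sub]
      have hω' : ε ≤ |inner ℝ (√(N : ℝ) • (X N ω - θ₀)) t -
          √(N : ℝ) * ∑ j, s j * (relFreq N (n N ω) j - S.cellProb θ₀ j)| := hω
      rw [hdiff, abs_mul, abs_of_nonneg (Real.sqrt_nonneg _)] at hω'
      have h4 : √(N : ℝ) * |inner ℝ (X N ω - θ₀ - mulVecCLM (S.influence β m θ₀) v) t| ≤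
          e * R * ‖t‖ := by
        calc _ ≤ √(N : ℝ) * ((e * ‖v‖) * ‖t‖) := by
              gcongr
              exact (abs_real_inner_le_norm _ _).trans (by gcongr)
          _ = e * (√(N : ℝ) * ‖v‖) * ‖t‖ := by ring
          _ ≤ e * R * ‖t‖ := by gcongr
      have h5 : e * R * ‖t‖ < ε := by
        have h6 : e * R * (‖t‖ + 1) = ε / 2 := by
          rw [he]
          field_simp
        have h7 : 0 < e * R := by positivity
        linarith
      linarith
  refine hgoal.congr fun N => ?_
  change _ = charFun ((P N).map _) t
  rw [charFun_apply, integral_map (hYm N) (by fun_prop)]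
  simp only [mul_comm]

end Asymptotics

end StepStress

theorem theorem2
    -- the experiment, the tuning parameter and the constraint
    (S : StepStress.Design) (β : ℝ) (hβ : 0 ≤ β) {r : ℕ}
    (m : StepStress.Param → EuclideanSpace ℝ (Fin r))
    (hm : ContDiffOn ℝ 1 m StepStress.paramSpace)
    (hM : ∀ θ ∈ StepStress.paramSpace, (StepStress.matM m θ).rank = r)
    -- the true parameter, which satisfies the constraint
    (θ₀ : StepStress.Param) (hθ₀ : θ₀ ∈ StepStress.paramSpace) (hmθ₀ : m θ₀ = 0)
    (hJ : IsUnit (S.matJ β θ₀))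
    -- for every sample size `N`, multinomial counts with the model probabilities at `θ₀`
    {Ω : ℕ → Type*} [∀ N, MeasurableSpace (Ω N)]
    (P : ∀ N, Measure (Ω N)) [∀ N, IsProbabilityMeasure (P N)]
    (n : ∀ N, Ω N → Fin (S.L + 1) → ℕ)
    (hn : ∀ N, StepStress.HasMultinomialLaw (P N) (n N) N (S.cellProb θ₀)) :
    -- there is a consistent sequence of roots, computed from the counts
    (∃ est : ℕ → (Fin (S.L + 1) → ℕ) → StepStress.Param,
      StepStress.WithProbTendstoOne P
        (fun N ω => S.IsRoot β m (StepStress.relFreq N (n N ω)) (est N (n N ω))) ∧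
      StepStress.TendstoInProb P (fun N ω => est N (n N ω)) θ₀) ∧
    -- the matrix `Σ_β(θ₀)` is a covariance matrix
    (S.matSigma β m θ₀).PosSemidef ∧
    -- every consistent sequence of roots is asymptotically normal
    (∀ X : ∀ N, Ω N → StepStress.Param, (∀ N, AEMeasurable (X N) (P N)) →
      StepStress.WithProbTendstoOne P
        (fun N ω => S.IsRoot β m (StepStress.relFreq N (n N ω)) (X N ω)) →
      StepStress.TendstoInProb P X θ₀ →
      TendstoInDistribution (fun (N : ℕ) ω => √(N : ℝ) • (X N ω - θ₀)) atTop id P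
        (multivariateGaussian 0 (S.matSigma β m θ₀))) ∧
    -- and so is every consistent sequence of restricted minimum divergence estimates
    (∀ X : ∀ N, Ω N → StepStress.Param, (∀ N, AEMeasurable (X N) (P N)) →
      StepStress.WithProbTendstoOne P
        (fun N ω => S.IsRMDPDE β m (StepStress.relFreq N (n N ω)) (X N ω)) →
      StepStress.TendstoInProb P X θ₀ →
      TendstoInDistribution (fun (N : ℕ) ω => √(N : ℝ) • (X N ω - θ₀)) atTop id P
        (multivariateGaussian 0 (S.matSigma β m θ₀))) := by
  have hq : ∀ j, 0 ≤ S.cellProb θ₀ j := fun j => (S.cellProb_pos hθ₀ j).le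
  have hq1 := S.sum_cellProb hθ₀
  have hroots : ∀ X : ∀ N, Ω N → StepStress.Param, (∀ N, AEMeasurable (X N) (P N)) →
      StepStress.WithProbTendstoOne P
        (fun N ω => S.IsRoot β m (StepStress.relFreq N (n N ω)) (X N ω)) →
      StepStress.TendstoInProb P X θ₀ →
      TendstoInDistribution (fun (N : ℕ) ω => √(N : ℝ) • (X N ω - θ₀)) atTop id P
        (multivariateGaussian 0 (S.matSigma β m θ₀)) := by
    intro X hX hroot hcons
    refine StepStress.tendstoInDistribution_of_expansion S β m hθ₀ hn hX fun ε hε => ?_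
    exact (hroot.and (hcons.withProbTendstoOne
      (S.eventually_root_expansion hm hM hθ₀ hmθ₀ hJ hε))).mono fun N ω h => h.2 _ h.1
  refine ⟨?_, S.posSemidef_matSigma β m hθ₀, hroots, fun X hX hmin hcons =>
    hroots X hX (hmin.mono fun N ω h => h.isRoot hβ hm hM) hcons⟩
  -- One estimator must serve every `ε`, so a nearly closest root is selected; the slack `1 / (N +
  -- 1)` tends to zero.
  have hsel := fun N : ℕ => StepStress.exists_nearest_selection (S.IsRoot β m) θ₀
    (Nat.one_div_pos_of_nat (α := ℝ) (n := N))
  choose g hg using hsel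
  have hnear : ∀ ε > 0, StepStress.WithProbTendstoOne P fun N ω =>
      ∃ θ, dist θ θ₀ < ε ∧ S.IsRoot β m (StepStress.relFreq N (n N ω)) θ := fun ε hε =>
    StepStress.withProbTendstoOne_relFreq hn hq hq1
      (S.eventually_exists_isRoot hβ hm hM hθ₀ hmθ₀ hJ hε)
  refine ⟨fun N c => g N (StepStress.relFreq N c),
    (hnear 1 one_pos).mono fun N ω h => (hg N _ 1 h).1, fun ε hε => ?_⟩
  refine tendsto_of_tendsto_of_tendsto_of_le_of_le' tendsto_const_nhds
    (hnear (ε / 2) (by positivity)) (Eventually.of_forall fun _ => zero_le) ?_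
  -- Once the slack is below `ε / 2`, a root within `ε / 2` of `θ₀` forces the selected one within
  -- `ε`.
  filter_upwards [tendsto_one_div_add_atTop_nhds_zero_nat.eventually
    (gt_mem_nhds (half_pos hε))] with N hN
  refine measure_mono fun ω hω hex => ?_
  have h1 := (hg N _ (ε / 2) hex).2
  have h2 : ε ≤ dist (g N (StepStress.relFreq N (n N ω))) θ₀ := hω
  linarith
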